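/- **Setting.** Let $\mathcal X$ be a finite set with a metric $d$, $\mathcal T=\{0,\dots,T\}$, $\mathcal I_c=\{1,\dots,m\}$, $\mathcal I=\{0\}\cup\mathcal I_c$, and $h:\mathcal X\times\mathcal T\times\mathcal I\to\mathbb R$, where $h(\cdot,\cdot,0)=f$ is the reward and $h(\cdot,\cdot,i)=c_i$, $i\in\mathcal I_c$, are the constraints. Let $\kappa$ be a positive (semi)definite kernel on $\mathcal X\times\mathcal T\times\mathcal I$ with $\kappa(z,z)\le 1$ for all $z$. Assume: 1. $h$ lies in the RKHS of $\kappa$ with norm at most $B$; $|h(x,t,i)-h(x',t,i)|\le L_x d(x,x')$ for all $x,x',t,i$; and there are $L(0),\dots,L(T)\ge 0$ with $|h(x,t+1,i)-h(x,t,i)|\le L(t)$ for all $x$, $i$ and $t<T$. 2. The observations at iteration $k$ (made at time $t=k$) are $y_k^i=h(x_k,k,i)+\varepsilon_k^i$, $i\in\mathcal I$, where the $\varepsilon_k^i$ are i.i.d., have mean zero, are $\sigma$-sub-Gaussian, and the noise of iteration $k$ is independent of the information available when $x_k$ is chosen. 3. $S_0\subseteq\mathcal X$ satisfies $c_i(x,0)>0$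 and $c_i(x,0)\ge L(0)$ for all $x\in S_0$, $i\in\mathcal I_c$. **Algorithm (TVSafeOpt).** Let $\lambda\ge 1$ be the noise variance of the Gaussian process model with mean zero and covariance $\kappa$, i.e. $\mu_{k-1}(x,i)$ and $\sigma_{k-1}(x,i)$ are the posterior mean and standard deviation of $h(x,k,i)$ given the observations of iterations $0,\dots,k-1$ under $\mathcal N(0,\lambda)$ noise. Let $C_0(x,i)=[L(0),\infty)$ if $x\in S_0$ and $i\in\mathcal I_c$, and $C_0(x,i)=\mathbb R$ otherwise. The first decision is some $x_0\in S_0$. For $k=1,\dots,T$ let $$Q_k(x,i)=[\mu_{k-1}(x,i)\pm\sqrt{\beta_k}\,\sigma_{k-1}(x,i)],\qquad C_k(x,i)=\bigl(C_{k-1}(x,i)\oplus[-L(k-1),L(k-1)]\bigr)\cap Q_k(x,i),$$ $l_k=\min C_k$, $u_k=\max C_k$, $w_k=u_k-l_k$, and $$S_k=\bigcap_{i\in\mathcal I_c}\bigcup_{x\in S_{k-1}}\{x'\in\mathcal X: l_k(x,i)-L_x d(x,x')-L(k)\ge 0\}.$$ If $S_k=\varnothing$ the algorithm stops. Otherwise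 $x_k$ is the decision in a maximizer of $w_k(x,i)$ over $x\in G_k\cup M_k$, $i\in\mathcal I$, where $M_k=\{x\in S_k: u_k(x,0)\ge\max_{x'\in S_k}l_k(x',0)\}$ and $G_k$ is the set of $x\in S_k$ for which some $x'\in\mathcal X\setminus S_k$ and $i\in\mathcal I_c$ satisfy $u_k(x,i)-L_x d(x,x')-L(k)\ge 0$. **Information capacity.** Let $\gamma_n$ be the maximum, over all choices $\mathbf X$ of $n$ distinct points $(x,t,i)\in\mathcal X\times\mathcal T\times\mathcal I$ with $t<n$, of the mutual information between the Gaussian process with mean zero and covariance $\kappa$ and its measurements at $\mathbf X$ with independent $\mathcal N(0,\lambda)$ noise. **Theorem.** Let $\delta\in(0,1)$ and $\sqrt{\beta_k}=B+\sigma\sqrt{2\left(\gamma_{k\cdot|\mathcal I|}+1+\ln(1/\delta)\right)}$. Then, with probability at least $1-\delta$, $c_i(x,k)\ge 0$ for all $k\in\{0,\dots,T\}$, all $x\in S_k$ and all $i\in\mathcal I_c$. -/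

import Mathlib

open MeasureTheory ProbabilityTheory
open scoped NNReal ENNReal Matrix Pointwise

noncomputable section

namespace TVSafeOpt

/-- Points `(x, t, i)`: a decision, a time in `{0, …, T}` and a function index in `{0, …, m}`.
Index `0` is the reward, the indices `1, …, m` are the constraints. -/
abbrev Point (X : Type*) (T m : ℕ) : Type _ := X × Fin (T + 1) × Fin (m + 1)

section Information

/-- Mutual information (in nats) of a pair of random elements with joint law `ν`: the
Kullback-Leibler divergence of the joint law from the product of its marginals. -/
def mutualInfo {A B : Type*} [MeasurableSpace A] [MeasurableSpace B] (ν : Measure (A × B)) :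
    ℝ≥0∞ :=
  InformationTheory.klDiv ν (ν.fst.prod ν.snd)

/-- Joint law of `(ĥ, h)`, where `h` is the centred Gaussian process on the finite set `Z` with
covariance `κ`, and `ĥ j = h (p j) + e j` are noisy measurements at the points `p j`, with
independent noise `e` of law `N(0, lam • 1)`. -/
def measurementLaw {Z : Type*} [Fintype Z] [DecidableEq Z] (κ : Matrix Z Z ℝ) (lam : ℝ)
    {n : ℕ} (p : Fin n → Z) : Measure (EuclideanSpace ℝ (Fin n) × EuclideanSpace ℝ Z) :=
  ((multivariateGaussian 0 κ).prod
    (multivariateGaussian 0 (lam • (1 : Matrix (Fin n) (Fin n) ℝ)))).map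
      (fun w => (WithLp.toLp 2 (fun j => w.1 (p j) + w.2 j), w.1))

/-- Information capacity `γ_n`: the maximal mutual information between the Gaussian process and
`n` noisy measurements of it, over all choices of `n` distinct data points with times before
`n`. -/
def infoCapacity {X : Type*} [Fintype X] [DecidableEq X] {T m : ℕ}
    (κ : Matrix (Point X T m) (Point X T m) ℝ) (lam : ℝ) (n : ℕ) : ℝ :=
  ⨆ p : {p : Fin n → Point X T m // Function.Injective p ∧ ∀ j, ((p j).2.1 : ℕ) < n},
    (mutualInfo (measurementLaw κ lam p.1)).toReal

end Information

/-- What the algorithm is given. -/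
structure Setup (X : Type*) (T m : ℕ) where
  /-- the spatio-temporal covariance kernel of the Gaussian process prior -/
  kernel : Matrix (Point X T m) (Point X T m) ℝ
  /-- the variance of the observation noise in the Gaussian process model -/
  modelVar : ℝ
  /-- the scaling `√β_k` of the confidence intervals -/
  sqrtBeta : Fin (T + 1) → ℝ
  /-- the Lipschitz constant with respect to decisions -/
  lipX : ℝ≥0
  /-- the bounds `L(t)` on the variation per time step -/
  lipT : Fin (T + 1) → ℝ
  /-- the safe seed `S_0` -/
  seed : Set X

namespace Setup

variable {X : Type*} {T m : ℕ} (A : Setup X T m)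
  (x : Fin (T + 1) → X) (y : Fin (T + 1) → Fin (m + 1) → ℝ)

/-- Index set of the scalar observations collected before iteration `k`. -/
abbrev DataIdx (T m : ℕ) (k : Fin (T + 1)) : Type := {j : Fin (T + 1) // j < k} × Fin (m + 1)

/-- The data point `(x_j, j, i)` of an observation. -/
def dataPoint (k : Fin (T + 1)) (q : DataIdx T m k) : Point X T m := (x q.1, q.1, q.2)

/-- Covariance matrix of the noisy observations collected before iteration `k`. -/
def gram (k : Fin (T + 1)) : Matrix (DataIdx T m k) (DataIdx T m k) ℝ :=
  Matrix.of (fun q r => A.kernel (dataPoint x k q) (dataPoint x k r)) + A.modelVar • 1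

/-- Covariances of the observations collected before iteration `k` with the value at `z`. -/
def cross (k : Fin (T + 1)) (z : Point X T m) : DataIdx T m k → ℝ :=
  fun q => A.kernel (dataPoint x k q) z

/-- Posterior mean `μ_{k-1}(a, i)` of `h(a, k, i)`, given the data of iterations `0, …, k-1`. -/
def postMean (k : Fin (T + 1)) (a : X) (i : Fin (m + 1)) : ℝ :=
  A.cross x k (a, k, i) ⬝ᵥ ((A.gram x k)⁻¹ *ᵥ (fun q => y q.1 q.2))

/-- Posterior standard deviation `σ_{k-1}(a, i)` of `h(a, k, i)`, given the same data. -/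
def postStd (k : Fin (T + 1)) (a : X) (i : Fin (m + 1)) : ℝ :=
  √(A.kernel (a, k, i) (a, k, i) -
    A.cross x k (a, k, i) ⬝ᵥ ((A.gram x k)⁻¹ *ᵥ A.cross x k (a, k, i)))

/-- The confidence interval `Q_k(a, i)`. -/
def confQ (k : Fin (T + 1)) (a : X) (i : Fin (m + 1)) : Set ℝ :=
  Set.Icc (A.postMean x y k a i - A.sqrtBeta k * A.postStd x k a i)
    (A.postMean x y k a i + A.sqrtBeta k * A.postStd x k a i)

/-- The initial interval `C_0(a, i)`: `[L(0), ∞)` for seed decisions and constraint indices,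
the whole line otherwise. -/
def confC0 (a : X) (i : Fin (m + 1)) : Set ℝ :=
  {v | a ∈ A.seed → i ≠ 0 → A.lipT 0 ≤ v}

/-- The intersected intervals
`C_k(a, i) = (C_{k-1}(a, i) ⊕ [-L(k-1), L(k-1)]) ∩ Q_k(a, i)`. -/
def confC (k : Fin (T + 1)) : X → Fin (m + 1) → Set ℝ :=
  Fin.induction (motive := fun _ => X → Fin (m + 1) → Set ℝ) A.confC0
    (fun t C a i => (C a i + Set.Icc (-A.lipT t.castSucc) (A.lipT t.castSucc)) ∩
      A.confQ x y t.succ a i) k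

/-- `l_k(a, i) = min C_k(a, i)`. -/
def lower (k : Fin (T + 1)) (a : X) (i : Fin (m + 1)) : ℝ := sInf (A.confC x y k a i)

/-- `u_k(a, i) = max C_k(a, i)`. -/
def upper (k : Fin (T + 1)) (a : X) (i : Fin (m + 1)) : ℝ := sSup (A.confC x y k a i)

/-- `w_k(a, i) = u_k(a, i) - l_k(a, i)`. -/
def width (k : Fin (T + 1)) (a : X) (i : Fin (m + 1)) : ℝ :=
  A.upper x y k a i - A.lower x y k a i

variable [MetricSpace X]

/-- The safe sets `S_k`. Once a safe set is empty, so are all later ones (if `m ≥ 1`). -/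
def safeSet (k : Fin (T + 1)) : Set X :=
  Fin.induction (motive := fun _ => Set X) A.seed
    (fun t S => {a' | ∀ i : Fin m, ∃ a ∈ S,
      0 ≤ A.lower x y t.succ a i.succ - A.lipX * dist a a' - A.lipT t.succ}) k

/-- The potential maximizers `M_k`. -/
def maximizers (k : Fin (T + 1)) : Set X :=
  {a ∈ A.safeSet x y k | ∀ a' ∈ A.safeSet x y k, A.lower x y k a' 0 ≤ A.upper x y k a 0}

/-- The number `e_k(a)` of decisions that sampling `a` might add to the safe set. -/
def expansion (k : Fin (T + 1)) (a : X) : ℕ :=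
  Set.ncard {a' | a' ∉ A.safeSet x y k ∧
    ∃ i : Fin m, 0 ≤ A.upper x y k a i.succ - A.lipX * dist a a' - A.lipT k}

/-- The potential expanders `G_k`. -/
def expanders (k : Fin (T + 1)) : Set X :=
  {a ∈ A.safeSet x y k | 0 < A.expansion x y k a}

/-- The decisions `x` and observations `y` result from a run of the algorithm: `x_0` is a seed
decision, and, as long as the safe set is non-empty, `x_k` is the decision in some maximizing
pair `(a, i)` of `w_k(a, i)` over `a ∈ G_k ∪ M_k` and all `i` (ties are broken in any way).
If a safe set is empty, the algorithm stops, and nothing is required from then on. -/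
structure IsRun : Prop where
  init : x 0 ∈ A.seed
  step : ∀ k : Fin (T + 1), 0 < k → (∀ j ≤ k, (A.safeSet x y j).Nonempty) →
    x k ∈ A.expanders x y k ∪ A.maximizers x y k ∧
    ∃ i, ∀ a ∈ A.expanders x y k ∪ A.maximizers x y k, ∀ i',
      A.width x y k a i' ≤ A.width x y k (x k) i

end Setup

/-- Noise model and flow of information. The scalar noises `ε k i` are i.i.d., have mean zero
and are `σ`-sub-Gaussian. `ℱ k` is what is known before the observations of iteration `k`:
the decision `x_k` is determined by it, the noises of earlier iterations belong to it, and the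
noises of iteration `k` are independent of it. -/
structure IsNoisySampling {X Ω : Type*} {T m : ℕ} [mΩ : MeasurableSpace Ω] (P : Measure Ω)
    (ℱ : Filtration ℕ mΩ) (σ : ℝ≥0) (x : Fin (T + 1) → Ω → X)
    (ε : Fin (T + 1) → Fin (m + 1) → Ω → ℝ) : Prop where
  decision_measurable : ∀ (k : Fin (T + 1)) (a : X), MeasurableSet[ℱ k] {ω | x k ω = a}
  noise_measurable : ∀ (k : Fin (T + 1)) i, Measurable[ℱ (k + 1)] (ε k i)
  noise_indep_past : ∀ k : Fin (T + 1),
    Indep (MeasurableSpace.comap (fun ω i => ε k i ω) inferInstance) (ℱ k) P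
  noise_indep : iIndepFun (fun (q : Fin (T + 1) × Fin (m + 1)) => ε q.1 q.2) P
  noise_identDistrib : ∀ k i k' i', IdentDistrib (ε k i) (ε k' i') P P
  noise_mean : ∀ k i, ∫ ω, ε k i ω ∂P = 0
  noise_subGaussian : ∀ k i, HasSubgaussianMGF (ε k i) (σ ^ 2) P

end TVSafeOpt

end

noncomputable section

namespace TVSafeOpt

/-! ### Cameron-Martin formula by coordinatewise shifts. -/

section CameronMartin

/-! The argument has a deterministic and a probabilistic half. Deterministically, if `h` lies in
every `Q_k` with `k ≥ 1`, then it lies in every `C_k`, so `l_k` bounds it from below, and the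
Lipschitz condition carries positivity to the points that enter `S_k` (`nonneg_of_mem_safeSet`).
Membership in `Q_k` comes from kernel ridge regression: by `abs_sub_posterior_mean_le` the error is
at most `(‖h‖ + √(E / λ))` times the posterior standard deviation, where `E = eᵀ K (K + λ)⁻¹ e` is
the energy of the past noise `e`.

It remains to bound `E` for all `k` at once, although the points are chosen adaptively. This is the
method of mixtures. Rescale the noise so that its sub-Gaussian variance proxy is `λ`. For each fixed
function `v`, the likelihood ratio of "`v` plus noise" against "pure noise", evaluated at the noise,
is a nonnegative supermartingale starting at `1`; hence so is its average over `v ∼ N(0, κ)`, the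
`evidence`. Ville's inequality (`mul_measure_exists_le_of_supermartingale`) keeps it below `1 / δ`
at all times with probability at least `1 - δ`, without a union bound.

Completing the square (`evidence_eq_exp_inv`) writes the evidence as its value at zero data times
`exp (E / (2 λ))`, with `E` the energy of the rescaled noise. Minus the logarithm of the value at
zero is exactly the mutual information of the measurements (`mutualInfo_measurementLaw`), hence at
most `γ`. No determinant is computed: both facts follow from the Cameron-Martin formula. Taking
logarithms and undoing the scaling gives `E ≤ 2 σ² (γ + log (1 / δ))`, and `λ ≥ 1` finishes. -/

lemma pi_withDensity {ι : Type*} [Fintype ι] {α : ι → Type*} [∀ i, MeasurableSpace (α i)]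
    (μ : ∀ i, Measure (α i)) [∀ i, IsProbabilityMeasure (μ i)] (f : ∀ i, α i → ℝ≥0∞)
    (hf : ∀ i, Measurable (f i)) [∀ i, SigmaFinite ((μ i).withDensity (f i))] :
    Measure.pi (fun i => (μ i).withDensity (f i)) =
      (Measure.pi μ).withDensity (fun x => ∏ i, f i (x i)) := by
  refine Measure.pi_eq fun s hs => ?_
  rw [withDensity_apply _ (MeasurableSet.univ_pi hs), ← lintegral_indicator (MeasurableSet.univ_pi hs)]
  have h1 : (Set.univ.pi s).indicator (fun x : ∀ i, α i => ∏ i, f i (x i)) =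
      fun x => ∏ i, (s i).indicator (f i) (x i) := by
    ext x
    by_cases hx : x ∈ Set.univ.pi s
    · rw [Set.indicator_of_mem hx]
      exact Finset.prod_congr rfl fun i _ => (Set.indicator_of_mem (hx i trivial) _).symm
    · rw [Set.indicator_of_notMem hx]
      simp only [Set.mem_pi, Set.mem_univ, true_implies, not_forall] at hx
      obtain ⟨i, hi⟩ := hx
      exact (Finset.prod_eq_zero (Finset.mem_univ i) (Set.indicator_of_notMem hi _)).symm
  have hind : iIndepFun (fun i (x : ∀ i, α i) => (s i).indicator (f i) (x i)) (Measure.pi μ) :=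
    iIndepFun_pi (X := fun i => (s i).indicator (f i))
      fun i => ((hf i).indicator (hs i)).aemeasurable
  rw [h1, lintegral_prod_eq_prod_lintegral_of_indepFun Finset.univ
    (fun i (x : ∀ i, α i) => (s i).indicator (f i) (x i)) hind
    (fun i => ((hf i).indicator (hs i)).comp (measurable_pi_apply i))]
  refine Finset.prod_congr rfl fun i _ => ?_
  rw [(measurePreserving_eval μ i).lintegral_comp ((hf i).indicator (hs i)),
    lintegral_indicator (hs i), withDensity_apply _ (hs i)]

lemma gaussianReal_eq_withDensity (b : ℝ) :
    gaussianReal b 1 = (gaussianReal 0 1).withDensity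
      (fun x => ENNReal.ofReal (Real.exp (b * x - b ^ 2 / 2))) := by
  rw [gaussianReal_of_var_ne_zero _ one_ne_zero, gaussianReal_of_var_ne_zero _ one_ne_zero,
    ← withDensity_mul _ (measurable_gaussianPDF _ _) (by fun_prop)]
  congr 1
  ext x
  rw [Pi.mul_apply, gaussianPDF_def, gaussianPDF_def, ← ENNReal.ofReal_mul (gaussianPDFReal_nonneg _ _ _)]
  simp only [gaussianPDFReal, NNReal.coe_one]
  rw [mul_assoc _ (Real.exp _), ← Real.exp_add]
  congr 3
  ring

lemma stdGaussian_map_add {ι : Type*} [Fintype ι] (b : EuclideanSpace ℝ ι) :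
    (stdGaussian (EuclideanSpace ℝ ι)).map (fun x => x + b) =
      (stdGaussian (EuclideanSpace ℝ ι)).withDensity
        (fun x => ENNReal.ofReal (Real.exp (∑ i, (b i * x i - b i ^ 2 / 2)))) := by
  have hsig : ∀ i, SigmaFinite ((gaussianReal 0 1).withDensity
      (fun x => ENNReal.ofReal (Real.exp (b i * x - b i ^ 2 / 2)))) := fun i => by
    rw [← gaussianReal_eq_withDensity]; infer_instance
  have hpi : (Measure.pi fun _ : ι => gaussianReal 0 1).map (fun x i => x i + b i) =
      (Measure.pi fun _ : ι => gaussianReal 0 1).withDensity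
        (fun x => ∏ i, ENNReal.ofReal (Real.exp (b i * x i - b i ^ 2 / 2))) := by
    rw [← pi_withDensity (fun _ : ι => gaussianReal 0 1)
      (fun i x => ENNReal.ofReal (Real.exp (b i * x - b i ^ 2 / 2))) (fun i => by fun_prop)]
    simp_rw [← gaussianReal_eq_withDensity]
    have : ∀ i, SigmaFinite ((gaussianReal 0 1).map (fun x => x + b i)) := fun i => by
      rw [gaussianReal_map_add_const]; infer_instance
    rw [Measure.pi_map_pi (μ := fun _ : ι => gaussianReal 0 1) (f := fun i (x : ℝ) => x + b i)
      (fun i => by fun_prop)]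
    simp_rw [gaussianReal_map_add_const, zero_add]
  have hm : Measurable (WithLp.toLp 2 : (ι → ℝ) → EuclideanSpace ℝ ι) := by fun_prop
  ext s hs
  rw [← map_pi_eq_stdGaussian, Measure.map_map (by fun_prop) hm, withDensity_apply _ hs,
    setLIntegral_map hs (by fun_prop) hm, Measure.map_apply (by fun_prop) hs]
  have h2 := congrArg (fun ν => ν ((WithLp.toLp 2 : (ι → ℝ) → EuclideanSpace ℝ ι) ⁻¹' s)) hpi
  simp only at h2
  rw [Measure.map_apply (by fun_prop) (hm hs), withDensity_apply _ (hm hs)] at h2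
  refine h2.trans (lintegral_congr fun x => ?_)
  rw [Real.exp_sum, ENNReal.ofReal_prod_of_nonneg fun i _ => (Real.exp_pos _).le]

open scoped MatrixOrder in
/-- The Cameron-Martin formula for centred Gaussian measures on a Euclidean space. -/
lemma lintegral_multivariateGaussian_add {ι : Type*} [Fintype ι] [DecidableEq ι]
    {S : Matrix ι ι ℝ} (hS : S.PosSemidef) (b : ι → ℝ) {f : EuclideanSpace ℝ ι → ℝ≥0∞}
    (hf : Measurable f) :
    ∫⁻ x, f (x + WithLp.toLp 2 (S *ᵥ b)) ∂(multivariateGaussian 0 S) =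
      ∫⁻ x, f x * ENNReal.ofReal (Real.exp (b ⬝ᵥ x.ofLp - b ⬝ᵥ (S *ᵥ b) / 2))
        ∂(multivariateGaussian 0 S) := by
  set R := CFC.sqrt S with hR
  have hRR : R * R = S := CFC.sqrt_mul_sqrt_self _ hS.nonneg
  have hRt : Rᵀ = R := by
    have := (CFC.sqrt_nonneg S).isSelfAdjoint
    rw [isSelfAdjoint_iff, Matrix.star_eq_conjTranspose, Matrix.conjTranspose_eq_transpose_of_trivial] at this
    exact this
  have hdot : ∀ u v : ι → ℝ, (R *ᵥ u) ⬝ᵥ v = u ⬝ᵥ (R *ᵥ v) := fun u v => by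
    rw [Matrix.dotProduct_mulVec, ← Matrix.mulVec_transpose, hRt]
  have hm : Measurable fun x : EuclideanSpace ℝ ι =>
      (0 : EuclideanSpace ℝ ι) + Matrix.toEuclideanCLM (𝕜 := ℝ) R x := by fun_prop
  rw [multivariateGaussian, lintegral_map (by fun_prop) hm, lintegral_map (by fun_prop) hm]
  -- `N(0, S)` is the image of the standard Gaussian under `R = √S`, and `S b = R (R b)`: a shift by
  -- `S b` is the image of a shift by `R b`.
  have h1 : ∀ x : EuclideanSpace ℝ ι,
      (0 : EuclideanSpace ℝ ι) + Matrix.toEuclideanCLM (𝕜 := ℝ) R x + WithLp.toLp 2 (S *ᵥ b) =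
      (0 : EuclideanSpace ℝ ι) +
        Matrix.toEuclideanCLM (𝕜 := ℝ) R (x + WithLp.toLp 2 (R *ᵥ b)) := fun x => by
    rw [map_add, ← add_assoc, ← hRR, ← Matrix.mulVec_mulVec]
    rfl
  simp_rw [h1]
  have hm2 : Measurable fun x : EuclideanSpace ℝ ι => f (0 + Matrix.toEuclideanCLM (𝕜 := ℝ) R x) :=
    hf.comp hm
  rw [← lintegral_map (μ := stdGaussian (EuclideanSpace ℝ ι))
    (f := fun x => f (0 + Matrix.toEuclideanCLM (𝕜 := ℝ) R x))
    (g := fun x => x + WithLp.toLp 2 (R *ᵥ b)) hm2 (by fun_prop), stdGaussian_map_add,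
    lintegral_withDensity_eq_lintegral_mul _ (by fun_prop) hm2]
  refine lintegral_congr fun x => ?_
  rw [Pi.mul_apply, mul_comm]
  congr 4
  rw [Finset.sum_sub_distrib, ← Finset.sum_div]
  congr 1
  · simp only [zero_add, Matrix.ofLp_toEuclideanCLM]
    rw [← hdot]; rfl
  · rw [← hRR, ← Matrix.mulVec_mulVec, ← hdot]
    simp [dotProduct, sq]

end CameronMartin

/-! ### The likelihood averaged over the Gaussian process, in closed form. -/

section Evidence

lemma posDef_submatrix_add_smul_one {Z ι : Type*} [DecidableEq ι] {κ : Matrix Z Z ℝ} {lam : ℝ}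
    (hκ : κ.PosSemidef) (hlam : 0 < lam) (p : ι → Z) :
    (κ.submatrix p p + lam • (1 : Matrix ι ι ℝ)).PosDef :=
  Matrix.PosDef.posSemidef_add (hκ.submatrix p) (Matrix.PosDef.one.smul hlam)

variable {Z ι : Type*} [Fintype ι]

/-- The density of the noisy measurements `w` at the points `p`, relative to the law of the noise
`N(0, lam • 1)`, when the measured function is `v`. -/
def likelihood (lam : ℝ) (p : ι → Z) (w : ι → ℝ) (v : EuclideanSpace ℝ Z) : ℝ≥0∞ :=
  ENNReal.ofReal (Real.exp (∑ j, (w j * v (p j) - v (p j) ^ 2 / 2) / lam))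

lemma measurable_likelihood_right (lam : ℝ) (p : ι → Z) (w : ι → ℝ) :
    Measurable (likelihood lam p w) := by
  unfold likelihood
  fun_prop

variable [Fintype Z] [DecidableEq Z]

/-- The likelihood averaged over the Gaussian process with covariance `κ`. -/
def evidence (κ : Matrix Z Z ℝ) (lam : ℝ) (p : ι → Z) (w : ι → ℝ) : ℝ≥0∞ :=
  ∫⁻ v, likelihood lam p w v ∂(multivariateGaussian 0 κ)

lemma evidence_comp_equiv {ι' : Type*} [Fintype ι'] (κ : Matrix Z Z ℝ) (lam : ℝ) (p : ι → Z)
    (w : ι → ℝ) (e : ι' ≃ ι) :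
    evidence κ lam (p ∘ e) (w ∘ e) = evidence κ lam p w := by
  simp only [evidence, likelihood, Function.comp_apply]
  refine lintegral_congr fun v => ?_
  rw [Equiv.sum_comp e (fun j => (w j * v (p j) - v (p j) ^ 2 / 2) / lam)]

variable {κ : Matrix Z Z ℝ} {lam : ℝ}

/-- At zero data every exponent is nonpositive. This is what makes the evidence finite for all data.
-/
lemma evidence_zero_le_one (κ : Matrix Z Z ℝ) (hlam : 0 < lam) (p : ι → Z) :
    evidence κ lam p 0 ≤ 1 := by
  calc evidence κ lam p 0 ≤ ∫⁻ _, 1 ∂(multivariateGaussian 0 κ) := by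
        refine lintegral_mono fun v => ?_
        rw [likelihood, ← ENNReal.ofReal_one]
        refine ENNReal.ofReal_le_ofReal (Real.exp_le_one_iff.2 (Finset.sum_nonpos fun j _ => ?_))
        refine div_nonpos_of_nonpos_of_nonneg ?_ hlam.le
        simp only [Pi.zero_apply, zero_mul, zero_sub]
        nlinarith [sq_nonneg (v (p j))]
    _ = 1 := by simp

lemma evidence_pos (κ : Matrix Z Z ℝ) (lam : ℝ) (p : ι → Z) (w : ι → ℝ) :
    0 < evidence κ lam p w := by
  rw [evidence, lintegral_pos_iff_support (measurable_likelihood_right lam p _)]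
  have : Function.support (fun v => likelihood lam p w v) = Set.univ :=
    Set.eq_univ_of_forall fun v => (ENNReal.ofReal_pos.2 (Real.exp_pos _)).ne'
  rw [this]
  simp

/-- Completing the square in the exponent of the Gaussian integral. -/
lemma evidence_eq [DecidableEq ι] (hκ : κ.PosSemidef) (hlam : 0 < lam) (p : ι → Z) (β : ι → ℝ) :
    evidence κ lam p (κ.submatrix p p *ᵥ β + lam • β) =
      evidence κ lam p 0 * ENNReal.ofReal (Real.exp
        ((κ.submatrix p p *ᵥ β) ⬝ᵥ (κ.submatrix p p *ᵥ β + lam • β) / (2 * lam))) := by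
  set u := κ.submatrix p p *ᵥ β with hu
  -- The transpose of evaluation at `p`, applied to `β`; the Cameron-Martin shift `κ b` then takes
  -- the values `u = K β` at the points `p`.
  set b : Z → ℝ := ∑ j, Pi.single (p j) (β j) with hb
  have hbdot : ∀ v : Z → ℝ, b ⬝ᵥ v = ∑ j, β j * v (p j) := fun v => by
    rw [hb, sum_dotProduct]
    simp
  have hκb : ∀ j, (κ *ᵥ b) (p j) = u j := fun j => by
    rw [Matrix.mulVec, dotProduct_comm, hbdot, hu, Matrix.mulVec, dotProduct]
    exact Finset.sum_congr rfl fun i _ => mul_comm _ _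
  -- Chosen so that the Cameron-Martin weight turns `f` into the likelihood of `u + λ β`, while
  -- shifting the argument by `κ b` turns it into a constant times the likelihood of zero data.
  let f : EuclideanSpace ℝ Z → ℝ≥0∞ := fun v => ENNReal.ofReal (Real.exp
    (∑ j, ((u j * v (p j) - v (p j) ^ 2 / 2) / lam + β j * u j / 2)))
  have hf : Measurable f := by fun_prop
  have key := lintegral_multivariateGaussian_add hκ b hf
  have h1 : evidence κ lam p (u + lam • β) = ∫⁻ x, f x * ENNReal.ofReal (Real.exp
      (b ⬝ᵥ x.ofLp - b ⬝ᵥ (κ *ᵥ b) / 2)) ∂(multivariateGaussian 0 κ) := by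
    refine lintegral_congr fun v => ?_
    simp only [f, likelihood]
    rw [← ENNReal.ofReal_mul (Real.exp_pos _).le, ← Real.exp_add, hbdot, hbdot, Finset.sum_div,
      ← Finset.sum_sub_distrib, ← Finset.sum_add_distrib]
    congr 2
    refine Finset.sum_congr rfl fun j _ => ?_
    rw [hκb]
    simp only [Pi.add_apply, Pi.smul_apply, smul_eq_mul]
    field_simp
    ring
  rw [h1, ← key, evidence, ← lintegral_mul_const _ (measurable_likelihood_right lam p _)]
  refine lintegral_congr fun v => ?_
  simp only [f, likelihood]
  rw [← ENNReal.ofReal_mul (Real.exp_pos _).le, ← Real.exp_add, dotProduct, Finset.sum_div,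
    ← Finset.sum_add_distrib]
  congr 2
  refine Finset.sum_congr rfl fun j _ => ?_
  simp only [PiLp.add_apply, hκb, Pi.add_apply, Pi.smul_apply, smul_eq_mul, Pi.zero_apply]
  field_simp
  ring

/-- Since `K + λ` is invertible, every `w` has the form `K β + λ β`, with `β = (K + λ)⁻¹ w`. -/
lemma evidence_eq_exp_inv [DecidableEq ι] (hκ : κ.PosSemidef) (hlam : 0 < lam) (p : ι → Z)
    (w : ι → ℝ) :
    evidence κ lam p w = evidence κ lam p 0 * ENNReal.ofReal (Real.exp
      (((κ.submatrix p p * (κ.submatrix p p + lam • (1 : Matrix ι ι ℝ))⁻¹) *ᵥ w) ⬝ᵥ w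
        / (2 * lam))) := by
  have hu := (posDef_submatrix_add_smul_one hκ hlam p).isUnit
  have hdet := (Matrix.isUnit_iff_isUnit_det _).1 hu
  have h := evidence_eq hκ hlam p ((κ.submatrix p p + lam • (1 : Matrix ι ι ℝ))⁻¹ *ᵥ w)
  have hw : κ.submatrix p p *ᵥ ((κ.submatrix p p + lam • (1 : Matrix ι ι ℝ))⁻¹ *ᵥ w) +
      lam • ((κ.submatrix p p + lam • (1 : Matrix ι ι ℝ))⁻¹ *ᵥ w) = w := by
    have : κ.submatrix p p *ᵥ ((κ.submatrix p p + lam • (1 : Matrix ι ι ℝ))⁻¹ *ᵥ w) +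
      lam • ((κ.submatrix p p + lam • (1 : Matrix ι ι ℝ))⁻¹ *ᵥ w) =
      (κ.submatrix p p + lam • (1 : Matrix ι ι ℝ)) *ᵥ
        ((κ.submatrix p p + lam • (1 : Matrix ι ι ℝ))⁻¹ *ᵥ w) := by
      rw [Matrix.add_mulVec, Matrix.smul_mulVec, Matrix.one_mulVec]
    rw [this, Matrix.mulVec_mulVec, Matrix.mul_nonsing_inv _ hdet, Matrix.one_mulVec]
  rw [hw] at h
  rw [h, Matrix.mulVec_mulVec]

end Evidence

/-! ### Mutual information as minus the logarithm of the evidence at zero. -/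

section MutualInformation

variable {Z : Type*} {n : ℕ}

lemma measurable_measurement (p : Fin n → Z) :
    Measurable (fun w : EuclideanSpace ℝ Z × EuclideanSpace ℝ (Fin n) =>
      ((WithLp.toLp 2 (fun j => w.1 (p j) + w.2 j) : EuclideanSpace ℝ (Fin n)), w.1)) := by
  fun_prop

lemma measurable_likelihood_toLp (lam : ℝ) (p : Fin n → Z) :
    Measurable (fun q : EuclideanSpace ℝ (Fin n) × EuclideanSpace ℝ Z =>
      likelihood lam p q.1.ofLp q.2) := by
  unfold likelihood
  fun_prop

variable [Fintype Z] [DecidableEq Z] {κ : Matrix Z Z ℝ} {lam : ℝ}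

lemma integrable_mul_multivariateGaussian {ι : Type*} [Fintype ι] [DecidableEq ι]
    (S : Matrix ι ι ℝ) (i j : ι) :
    Integrable (fun v : EuclideanSpace ℝ ι => v i * v j) (multivariateGaussian 0 S) := by
  have h : ∀ i, MemLp (fun v : EuclideanSpace ℝ ι => v i) 2 (multivariateGaussian 0 S) := fun i =>
    IsGaussian.memLp_dual (multivariateGaussian 0 S) (EuclideanSpace.proj i) 2 (by simp)
  exact (h i).integrable_mul (h j)

lemma integrable_eval_multivariateGaussian {ι : Type*} [Fintype ι] [DecidableEq ι]
    (S : Matrix ι ι ℝ) (i : ι) :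
    Integrable (fun v : EuclideanSpace ℝ ι => v i) (multivariateGaussian 0 S) :=
  IsGaussian.integrable_dual (multivariateGaussian 0 S) (EuclideanSpace.proj i)

lemma integral_eval_multivariateGaussian {ι : Type*} [Fintype ι] [DecidableEq ι]
    (S : Matrix ι ι ℝ) (i : ι) :
    ∫ v, v i ∂(multivariateGaussian 0 S) = 0 := by
  have := (EuclideanSpace.proj i : EuclideanSpace ℝ ι →L[ℝ] ℝ).integral_comp_comm
    (IsGaussian.integrable_fun_id (μ := multivariateGaussian 0 S))
  simpa using this

lemma integral_mul_multivariateGaussian {ι : Type*} [Fintype ι] [DecidableEq ι]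
    {S : Matrix ι ι ℝ} (hS : S.PosSemidef) (i j : ι) :
    ∫ v, v i * v j ∂(multivariateGaussian 0 S) = S i j := by
  have h : ∀ i, MemLp (fun v : EuclideanSpace ℝ ι => v i) 2 (multivariateGaussian 0 S) := fun i =>
    IsGaussian.memLp_dual (multivariateGaussian 0 S) (EuclideanSpace.proj i) 2 (by simp)
  rw [← covariance_eval_multivariateGaussian (μ := 0) hS i j, covariance_eq_sub (h i) (h j),
    integral_eval_multivariateGaussian]
  simp

instance isProbabilityMeasure_measurementLaw (κ : Matrix Z Z ℝ) (lam : ℝ) (p : Fin n → Z) :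
    IsProbabilityMeasure (measurementLaw κ lam p) :=
  Measure.isProbabilityMeasure_map (measurable_measurement p).aemeasurable

lemma measurable_evidence_toLp (κ : Matrix Z Z ℝ) (lam : ℝ) (p : Fin n → Z) :
    Measurable (fun e : EuclideanSpace ℝ (Fin n) => evidence κ lam p e.ofLp) :=
  (measurable_likelihood_toLp lam p).lintegral_prod_right'

/-- For a fixed function `v`, measuring it shifts the noise by `v ∘ p`; Cameron-Martin for the noise
law trades this shift for the likelihood. -/
lemma lintegral_measurementLaw (hlam : 0 < lam) (p : Fin n → Z)
    {F : EuclideanSpace ℝ (Fin n) × EuclideanSpace ℝ Z → ℝ≥0∞} (hF : Measurable F) :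
    ∫⁻ q, F q ∂(measurementLaw κ lam p) =
      ∫⁻ q, likelihood lam p q.1.ofLp q.2 * F q
        ∂((multivariateGaussian 0 (lam • (1 : Matrix (Fin n) (Fin n) ℝ))).prod
          (multivariateGaussian 0 κ)) := by
  have hpsd : (lam • (1 : Matrix (Fin n) (Fin n) ℝ)).PosSemidef :=
    Matrix.PosSemidef.one.smul hlam.le
  rw [measurementLaw, lintegral_map hF (measurable_measurement p), lintegral_prod
    (fun w : EuclideanSpace ℝ Z × EuclideanSpace ℝ (Fin n) =>
      F (WithLp.toLp 2 (fun j => w.1 (p j) + w.2 j), w.1))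
    (hF.comp (measurable_measurement p)).aemeasurable, lintegral_prod_symm'
    (fun q : EuclideanSpace ℝ (Fin n) × EuclideanSpace ℝ Z => likelihood lam p q.1.ofLp q.2 * F q)
    ((measurable_likelihood_toLp lam p).mul hF)]
  refine lintegral_congr fun v => ?_
  -- Division by `lam` because the covariance `lam • 1` multiplies by it again.
  have key := lintegral_multivariateGaussian_add hpsd (fun j => v (p j) / lam)
    (f := fun e => F (e, v)) (by fun_prop)
  have hs : (lam • (1 : Matrix (Fin n) (Fin n) ℝ)) *ᵥ (fun j => v (p j) / lam) =
      fun j => v (p j) := by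
    rw [Matrix.smul_mulVec, Matrix.one_mulVec]
    ext j
    simp only [Pi.smul_apply, smul_eq_mul]
    field_simp
  rw [hs] at key
  convert key using 1
  · refine lintegral_congr fun e => ?_
    congr 2
    ext j
    exact add_comm _ _
  · refine lintegral_congr fun e => ?_
    rw [mul_comm, likelihood]
    congr 3
    simp only [dotProduct]
    rw [Finset.sum_div, ← Finset.sum_sub_distrib]
    refine Finset.sum_congr rfl fun j _ => ?_
    ring

lemma measurementLaw_eq_withDensity (hlam : 0 < lam) (p : Fin n → Z) :
    measurementLaw κ lam p =
      ((multivariateGaussian 0 (lam • (1 : Matrix (Fin n) (Fin n) ℝ))).prod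
        (multivariateGaussian 0 κ)).withDensity (fun q => likelihood lam p q.1.ofLp q.2) := by
  ext s hs
  rw [← lintegral_indicator_one hs, lintegral_measurementLaw hlam p (by measurability),
    withDensity_apply _ hs, ← lintegral_indicator hs]
  refine lintegral_congr fun q => ?_
  by_cases hq : q ∈ s <;> simp [hq]

lemma fst_measurementLaw (hlam : 0 < lam) (p : Fin n → Z) :
    (measurementLaw κ lam p).fst =
      (multivariateGaussian 0 (lam • (1 : Matrix (Fin n) (Fin n) ℝ))).withDensity
        (fun e => evidence κ lam p e.ofLp) := by
  ext s hs
  rw [Measure.fst_apply hs, measurementLaw_eq_withDensity hlam,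
    withDensity_apply _ (measurable_fst hs), withDensity_apply _ hs,
    ← Set.prod_univ, ← Measure.prod_restrict, Measure.restrict_univ,
    lintegral_prod _ (measurable_likelihood_toLp lam p).aemeasurable]
  rfl

lemma snd_measurementLaw (κ : Matrix Z Z ℝ) (lam : ℝ) (p : Fin n → Z) :
    (measurementLaw κ lam p).snd = multivariateGaussian 0 κ := by
  rw [Measure.snd, measurementLaw, Measure.map_map measurable_snd (measurable_measurement p)]
  exact Measure.fst_prod

lemma evidence_ne_top (hκ : κ.PosSemidef) (hlam : 0 < lam) {ι : Type*} [Fintype ι] [DecidableEq ι]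
    (p : ι → Z) (w : ι → ℝ) : evidence κ lam p w ≠ ∞ := by
  rw [evidence_eq_exp_inv hκ hlam]
  exact ENNReal.mul_ne_top ((evidence_zero_le_one κ hlam p).trans_lt ENNReal.one_lt_top).ne
    ENNReal.ofReal_ne_top

/-- Bayes' rule: relative to noise times prior, the joint law has the likelihood as density, and its
first marginal has the evidence. The quotient is well defined because the evidence is positive and
finite. -/
lemma measurementLaw_eq_withDensity_prod (hκ : κ.PosSemidef) (hlam : 0 < lam) (p : Fin n → Z) :
    measurementLaw κ lam p =
      ((measurementLaw κ lam p).fst.prod (measurementLaw κ lam p).snd).withDensity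
        (fun q => likelihood lam p q.1.ofLp q.2 / evidence κ lam p q.1.ofLp) := by
  have hD := measurable_evidence_toLp κ lam p
  have hG := measurable_likelihood_toLp lam p
  have : SigmaFinite ((multivariateGaussian 0 (lam • (1 : Matrix (Fin n) (Fin n) ℝ))).withDensity
        (fun e => evidence κ lam p e.ofLp)) := by
    rw [← fst_measurementLaw hlam]; infer_instance
  rw [snd_measurementLaw, fst_measurementLaw hlam, prod_withDensity_left hD,
    ← withDensity_mul _ (f := fun q : EuclideanSpace ℝ (Fin n) × EuclideanSpace ℝ Z =>
      evidence κ lam p q.1.ofLp) (g := fun q => likelihood lam p q.1.ofLp q.2 /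
      evidence κ lam p q.1.ofLp) (hD.comp measurable_fst) (hG.div (hD.comp measurable_fst)),
    measurementLaw_eq_withDensity hlam]
  congr 1
  ext q
  rw [Pi.mul_apply, ENNReal.mul_div_cancel (evidence_pos _ _ _ _).ne' (evidence_ne_top hκ hlam p _)]

lemma llr_measurementLaw (hκ : κ.PosSemidef) (hlam : 0 < lam) (p : Fin n → Z) :
    llr (measurementLaw κ lam p)
        ((measurementLaw κ lam p).fst.prod (measurementLaw κ lam p).snd)
      =ᵐ[measurementLaw κ lam p] fun q =>
        (∑ j, (q.1 j * q.2 (p j) - q.2 (p j) ^ 2 / 2) / lam) -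
          ((((κ.submatrix p p * (κ.submatrix p p + lam • (1 : Matrix _ _ ℝ))⁻¹) *ᵥ q.1.ofLp) ⬝ᵥ
            q.1.ofLp) / (2 * lam)) - Real.log (evidence κ lam p 0).toReal := by
  have h := measurementLaw_eq_withDensity_prod hκ hlam p
  set M := (measurementLaw κ lam p).fst.prod (measurementLaw κ lam p).snd with hM
  have hac : measurementLaw κ lam p ≪ M := by
    rw [h]; exact withDensity_absolutelyContinuous _ _
  have hr : (measurementLaw κ lam p).rnDeriv M =ᵐ[M]
      fun q => likelihood lam p q.1.ofLp q.2 / evidence κ lam p q.1.ofLp := by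
    nth_rewrite 1 [h]
    exact Measure.rnDeriv_withDensity _
      ((measurable_likelihood_toLp lam p).div ((measurable_evidence_toLp κ lam p).comp measurable_fst))
  filter_upwards [hac hr] with q hq
  have h0 : (evidence κ lam p 0).toReal ≠ 0 := (ENNReal.toReal_pos (evidence_pos _ _ _ _).ne'
    (evidence_ne_top hκ hlam p _)).ne'
  rw [llr, hq, evidence_eq_exp_inv hκ hlam, ENNReal.toReal_div, ENNReal.toReal_mul, likelihood,
    ENNReal.toReal_ofReal (Real.exp_pos _).le, ENNReal.toReal_ofReal (Real.exp_pos _).le,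
    Real.log_div (Real.exp_pos _).ne' (mul_ne_zero h0 (Real.exp_pos _).ne'),
    Real.log_mul h0 (Real.exp_pos _).ne', Real.log_exp, Real.log_exp]
  ring

/-- The divergence is the expected log-likelihood ratio. Its two random terms both have mean `tr K /
(2 λ)` and cancel, which leaves only the constant. -/
lemma mutualInfo_measurementLaw (hκ : κ.PosSemidef) (hlam : 0 < lam) (p : Fin n → Z) :
    (mutualInfo (measurementLaw κ lam p)).toReal = -Real.log (evidence κ lam p 0).toReal := by
  have hpsd : (lam • (1 : Matrix (Fin n) (Fin n) ℝ)).PosSemidef :=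
    Matrix.PosSemidef.one.smul hlam.le
  have hac : measurementLaw κ lam p ≪
      (measurementLaw κ lam p).fst.prod (measurementLaw κ lam p).snd := by
    nth_rewrite 1 [measurementLaw_eq_withDensity_prod hκ hlam p]
    exact withDensity_absolutelyContinuous _ _
  rw [mutualInfo, InformationTheory.toReal_klDiv_of_measure_eq hac (by simp),
    integral_congr_ae (llr_measurementLaw hκ hlam p)]
  set K := κ.submatrix p p with hK
  set A := K * (K + lam • (1 : Matrix _ _ ℝ))⁻¹ with hA
  set c := Real.log (evidence κ lam p 0).toReal
  set ρ := multivariateGaussian 0 κ with hρ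
  set τ := multivariateGaussian 0 (lam • (1 : Matrix (Fin n) (Fin n) ℝ)) with hτ
  have hvv : ∀ i j, Integrable (fun w : EuclideanSpace ℝ Z × EuclideanSpace ℝ (Fin n) =>
      w.1 (p i) * w.1 (p j)) (ρ.prod τ) := fun i j =>
    (integrable_mul_multivariateGaussian κ (p i) (p j)).comp_fst τ
  have hee : ∀ i j, Integrable (fun w : EuclideanSpace ℝ Z × EuclideanSpace ℝ (Fin n) =>
      w.2 i * w.2 j) (ρ.prod τ) := fun i j =>
    (integrable_mul_multivariateGaussian (lam • (1 : Matrix (Fin n) (Fin n) ℝ)) i j).comp_snd ρ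
  have hve : ∀ i j, Integrable (fun w : EuclideanSpace ℝ Z × EuclideanSpace ℝ (Fin n) =>
      w.1 (p i) * w.2 j) (ρ.prod τ) := fun i j =>
    (integrable_eval_multivariateGaussian κ (p i)).mul_prod
      (integrable_eval_multivariateGaussian (lam • (1 : Matrix (Fin n) (Fin n) ℝ)) j)
  have ivv : ∀ i j, ∫ w, w.1 (p i) * w.1 (p j) ∂(ρ.prod τ) = K i j := fun i j => by
    rw [integral_fun_fst (fun v : EuclideanSpace ℝ Z => v (p i) * v (p j)),
      integral_mul_multivariateGaussian hκ]
    simp [hK]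
  have iee : ∀ i j, ∫ w, w.2 i * w.2 j ∂(ρ.prod τ) = (lam • (1 : Matrix (Fin n) (Fin n) ℝ)) i j :=
    fun i j => by
      rw [integral_fun_snd (fun v : EuclideanSpace ℝ (Fin n) => v i * v j),
        integral_mul_multivariateGaussian hpsd]
      simp
  have ive : ∀ i j, ∫ w, w.1 (p i) * w.2 j ∂(ρ.prod τ) = 0 := fun i j => by
    rw [integral_prod_mul (fun v : EuclideanSpace ℝ Z => v (p i))
      (fun e : EuclideanSpace ℝ (Fin n) => e j), integral_eval_multivariateGaussian, zero_mul]
  have hxx : ∀ i j, Integrable (fun w : EuclideanSpace ℝ Z × EuclideanSpace ℝ (Fin n) =>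
      (w.1 (p j) + w.2 j) * (w.1 (p i) + w.2 i)) (ρ.prod τ) := fun i j => by
    refine ((((hvv j i).add (hve j i)).add (hve i j)).add (hee j i)).congr (ae_of_all _ fun w => ?_)
    simp only [Pi.add_apply]
    ring
  -- The measurements have covariance `K + λ`, as signal and noise are independent and centred.
  have ixx : ∀ i j, ∫ w, (w.1 (p j) + w.2 j) * (w.1 (p i) + w.2 i) ∂(ρ.prod τ) =
      (K + lam • (1 : Matrix (Fin n) (Fin n) ℝ)) j i := fun i j => by
    have : ∀ w : EuclideanSpace ℝ Z × EuclideanSpace ℝ (Fin n),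
        (w.1 (p j) + w.2 j) * (w.1 (p i) + w.2 i) =
        w.1 (p j) * w.1 (p i) + w.1 (p j) * w.2 i + w.1 (p i) * w.2 j + w.2 j * w.2 i :=
      fun w => by ring
    have h1 : Integrable (fun w : EuclideanSpace ℝ Z × EuclideanSpace ℝ (Fin n) =>
        w.1 (p j) * w.1 (p i) + w.1 (p j) * w.2 i) (ρ.prod τ) := (hvv j i).add (hve j i)
    have h2 : Integrable (fun w : EuclideanSpace ℝ Z × EuclideanSpace ℝ (Fin n) =>
        w.1 (p j) * w.1 (p i) + w.1 (p j) * w.2 i + w.1 (p i) * w.2 j) (ρ.prod τ) :=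
      h1.add (hve i j)
    simp_rw [this]
    rw [integral_add h2 (hee j i), integral_add h1 (hve i j), integral_add (hvv j i) (hve j i),
      ivv, ive, ive, iee, Matrix.add_apply]
    ring
  have hquad : ∀ x : Fin n → ℝ, (A *ᵥ x) ⬝ᵥ x = ∑ i, ∑ j, A i j * (x j * x i) := fun x => by
    simp only [dotProduct, Matrix.mulVec, Finset.sum_mul, mul_assoc]
  have hmeas : Measurable (fun q : EuclideanSpace ℝ (Fin n) × EuclideanSpace ℝ Z =>
      (∑ j, (q.1 j * q.2 (p j) - q.2 (p j) ^ 2 / 2) / lam) -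
          (((A *ᵥ q.1.ofLp) ⬝ᵥ q.1.ofLp) / (2 * lam)) - c) := by
    simp_rw [hquad]
    fun_prop
  rw [measurementLaw, integral_map (measurable_measurement p).aemeasurable
    hmeas.aestronglyMeasurable, ← hρ, ← hτ]
  simp_rw [hquad]
  have hA1 : ∀ j, Integrable (fun w : EuclideanSpace ℝ Z × EuclideanSpace ℝ (Fin n) =>
      ((w.1 (p j) + w.2 j) * w.1 (p j) - w.1 (p j) ^ 2 / 2) / lam) (ρ.prod τ) := fun j => by
    refine ((((hvv j j).add (hve j j)).sub ((hvv j j).div_const 2)).div_const lam).congr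
      (ae_of_all _ fun w => ?_)
    simp only [Pi.add_apply, Pi.sub_apply]
    ring
  have iA1 : ∀ j, ∫ w, ((w.1 (p j) + w.2 j) * w.1 (p j) - w.1 (p j) ^ 2 / 2) / lam ∂(ρ.prod τ) =
      K j j / (2 * lam) := fun j => by
    have : ∀ w : EuclideanSpace ℝ Z × EuclideanSpace ℝ (Fin n),
        ((w.1 (p j) + w.2 j) * w.1 (p j) - w.1 (p j) ^ 2 / 2) / lam =
        (1 / (2 * lam)) * (w.1 (p j) * w.1 (p j)) + (1 / lam) * (w.1 (p j) * w.2 j) :=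
      fun w => by field_simp; ring
    simp_rw [this]
    rw [integral_add ((hvv j j).const_mul _) ((hve j j).const_mul _), integral_const_mul,
      integral_const_mul, ivv, ive]
    ring
  have hI1 := integrable_finsetSum Finset.univ fun j _ => hA1 j
  have hI2 : Integrable (fun w : EuclideanSpace ℝ Z × EuclideanSpace ℝ (Fin n) =>
      ∑ i, ∑ j, A i j * ((w.1 (p j) + w.2 j) * (w.1 (p i) + w.2 i))) (ρ.prod τ) :=
    integrable_finsetSum _ fun i _ => integrable_finsetSum _ fun j _ => (hxx i j).const_mul _
  -- Hence the quadratic form has mean `tr (A (K + λ)) = tr K`.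
  have hAK : A * (K + lam • (1 : Matrix _ _ ℝ)) = K := by
    have hdet := (Matrix.isUnit_iff_isUnit_det _).1 (posDef_submatrix_add_smul_one hκ hlam p).isUnit
    rw [hA, Matrix.mul_assoc, Matrix.nonsing_inv_mul _ hdet, Matrix.mul_one]
  have hI12 : Integrable (fun w : EuclideanSpace ℝ Z × EuclideanSpace ℝ (Fin n) =>
      ∑ j, ((w.1 (p j) + w.2 j) * w.1 (p j) - w.1 (p j) ^ 2 / 2) / lam -
      (∑ i, ∑ j, A i j * ((w.1 (p j) + w.2 j) * (w.1 (p i) + w.2 i))) / (2 * lam)) (ρ.prod τ) :=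
    hI1.sub (hI2.div_const _)
  have hQ : ∫ w, ∑ i, ∑ j, A i j * ((w.1 (p j) + w.2 j) * (w.1 (p i) + w.2 i)) ∂(ρ.prod τ) =
      ∑ i, K i i := by
    refine (integral_finsetSum Finset.univ fun i _ => integrable_finsetSum Finset.univ
      fun j _ => (hxx i j).const_mul (A i j)).trans (Finset.sum_congr rfl fun i _ => ?_)
    refine (integral_finsetSum Finset.univ fun j _ => (hxx i j).const_mul (A i j)).trans ?_
    simp_rw [integral_const_mul, ixx]
    rw [← Matrix.mul_apply, hAK]
  rw [integral_sub hI12 (integrable_const _), integral_sub hI1 (hI2.div_const _),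
    integral_finsetSum _ fun j _ => hA1 j, integral_div, hQ]
  simp_rw [iA1]
  rw [← Finset.sum_div]
  simp

end MutualInformation

/-- Enumerating the index set makes the points an admissible choice in the supremum, which ranges
over a finite set and is thus bounded. -/
lemma neg_log_evidence_le_infoCapacity {X : Type*} [Fintype X] [DecidableEq X] {T m : ℕ}
    {κ : Matrix (Point X T m) (Point X T m) ℝ} {lam : ℝ} (hκ : κ.PosSemidef) (hlam : 0 < lam)
    {ι : Type*} [Fintype ι] {n : ℕ} (hn : Fintype.card ι = n) (p : ι → Point X T m)
    (hp : Function.Injective p) (ht : ∀ j, ((p j).2.1 : ℕ) < n) :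
    -Real.log (evidence κ lam p 0).toReal ≤ infoCapacity κ lam n := by
  let e : Fin n ≃ ι := (Fintype.equivFinOfCardEq hn).symm
  have h1 : evidence κ lam (p ∘ e) 0 = evidence κ lam p 0 := evidence_comp_equiv κ lam p 0 e
  rw [← h1, ← mutualInfo_measurementLaw hκ hlam]
  exact le_ciSup (f := fun p : {p : Fin n → Point X T m // Function.Injective p ∧
      ∀ j, ((p j).2.1 : ℕ) < n} => (mutualInfo (measurementLaw κ lam p.1)).toReal)
    (Set.finite_range _).bddAbove ⟨p ∘ e, hp.comp e.injective, fun j => ht (e j)⟩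

/-! ### Error of kernel ridge regression in a Hilbert space. -/

section Regression

open scoped RealInnerProductSpace

lemma mul_add_mul_le_sqrt_mul_sqrt {lam : ℝ} (hlam : 0 < lam) (a b c d : ℝ) :
    |a * b + c * d| ≤ √(a ^ 2 + lam * c ^ 2) * √(b ^ 2 + d ^ 2 / lam) := by
  rw [← Real.sqrt_mul (by positivity)]
  refine Real.abs_le_sqrt ?_
  -- Lagrange's identity behind the weighted Cauchy-Schwarz inequality.
  have h : (a ^ 2 + lam * c ^ 2) * (b ^ 2 + d ^ 2 / lam) =
      (a * b + c * d) ^ 2 + lam * (a * d / lam - c * b) ^ 2 := by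
    field_simp
    ring
  rw [h]
  have : 0 ≤ lam * (a * d / lam - c * b) ^ 2 := by positivity
  linarith

variable {Z ι H : Type*} [Fintype ι] [NormedAddCommGroup H]
  [InnerProductSpace ℝ H] {κ : Matrix Z Z ℝ} {lam : ℝ} {φ : Z → H}

lemma inner_sum_feature (hφ : ∀ z z', ⟪φ z, φ z'⟫ = κ z z') (p : ι → Z) (z : Z) (a : ι → ℝ) :
    ⟪φ z, ∑ j, a j • φ (p j)⟫ = a ⬝ᵥ (fun j => κ (p j) z) := by
  rw [inner_sum, dotProduct]
  refine Finset.sum_congr rfl fun j _ => ?_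
  rw [inner_smul_right, real_inner_comm, hφ]

lemma inner_sum_feature_sum_feature (hφ : ∀ z z', ⟪φ z, φ z'⟫ = κ z z') (p : ι → Z)
    (a b : ι → ℝ) :
    ⟪∑ j, a j • φ (p j), ∑ j, b j • φ (p j)⟫ = a ⬝ᵥ (κ.submatrix p p *ᵥ b) := by
  rw [sum_inner, dotProduct]
  refine Finset.sum_congr rfl fun i _ => ?_
  rw [inner_smul_left, inner_sum_feature hφ, dotProduct_comm]
  simp only [conj_trivial, Matrix.mulVec, dotProduct, Matrix.submatrix_apply]
  congr 1
  refine Finset.sum_congr rfl fun j _ => ?_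
  rw [← hφ, ← hφ, real_inner_comm]

/-- The error of kernel ridge regression, in terms of the posterior standard deviation. -/
lemma abs_sub_posterior_mean_le [DecidableEq ι] (hφ : ∀ z z', ⟪φ z, φ z'⟫ = κ z z') (hκ : κ.PosSemidef)
    (hlam : 0 < lam) (p : ι → Z) (z : Z) (f : H) (e : ι → ℝ) :
    |⟪f, φ z⟫ - (fun j => κ (p j) z) ⬝ᵥ ((κ.submatrix p p + lam • (1 : Matrix ι ι ℝ))⁻¹ *ᵥ
        fun j => ⟪f, φ (p j)⟫ + e j)| ≤
      (‖f‖ + √(((κ.submatrix p p * (κ.submatrix p p + lam • (1 : Matrix ι ι ℝ))⁻¹) *ᵥ e) ⬝ᵥ e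
        / lam)) *
      √(κ z z - (fun j => κ (p j) z) ⬝ᵥ ((κ.submatrix p p + lam • (1 : Matrix ι ι ℝ))⁻¹ *ᵥ
        fun j => κ (p j) z)) := by
  set K := κ.submatrix p p with hK
  set G := K + lam • (1 : Matrix ι ι ℝ) with hG
  set c : ι → ℝ := fun j => κ (p j) z with hc
  have hpos := posDef_submatrix_add_smul_one hκ hlam p
  have hdet : IsUnit G.det := (Matrix.isUnit_iff_isUnit_det _).1 hpos.isUnit
  have hGt : (G⁻¹)ᵀ = G⁻¹ := by
    have h := hpos.isHermitian.inv
    rwa [Matrix.IsHermitian, Matrix.conjTranspose_eq_transpose_of_trivial] at h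
  set α := G⁻¹ *ᵥ c with hα
  set β := G⁻¹ *ᵥ e with hβ
  have hG_mul : ∀ u, K *ᵥ (G⁻¹ *ᵥ u) + lam • (G⁻¹ *ᵥ u) = u := fun u => by
    have : G *ᵥ (G⁻¹ *ᵥ u) = u := by
      rw [Matrix.mulVec_mulVec, Matrix.mul_nonsing_inv _ hdet, Matrix.one_mulVec]
    rwa [hG, Matrix.add_mulVec, Matrix.smul_mulVec, Matrix.one_mulVec] at this
  have hsymm : ∀ u v, u ⬝ᵥ (G⁻¹ *ᵥ v) = (G⁻¹ *ᵥ u) ⬝ᵥ v := fun u v => by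
    rw [Matrix.dotProduct_mulVec, ← Matrix.mulVec_transpose, hGt]
  have hKα : K *ᵥ α = c - lam • α := eq_sub_of_add_eq (hG_mul c)
  have he : e = K *ᵥ β + lam • β := (hG_mul e).symm
  set r := φ z - ∑ j, α j • φ (p j) with hr
  set ψ := ∑ j, β j • φ (p j) with hψ
  set x := K *ᵥ β with hx
  -- The posterior variance splits into the squared residual of `φ z` and a ridge penalty. The first
  -- part alone controls the bias `⟪f, r⟫`; the noise term needs both.
  have hr_sq : ‖r‖ ^ 2 + lam * (α ⬝ᵥ α) = κ z z - c ⬝ᵥ α := by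
    rw [hr, norm_sub_sq_real, ← real_inner_self_eq_norm_sq, ← real_inner_self_eq_norm_sq, hφ,
      inner_sum_feature hφ, inner_sum_feature_sum_feature hφ, ← hK, hKα, dotProduct_sub,
      dotProduct_smul, smul_eq_mul, dotProduct_comm c α]
    ring
  -- The noise energy splits with the weights dual to those of the posterior variance, so that the
  -- weighted Cauchy-Schwarz inequality pairs the two.
  have hψ_sq : ‖ψ‖ ^ 2 + (x ⬝ᵥ x) / lam = x ⬝ᵥ e / lam := by
    rw [← real_inner_self_eq_norm_sq, hψ, inner_sum_feature_sum_feature hφ, ← hK, ← hx, he,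
      dotProduct_add, dotProduct_smul, smul_eq_mul, dotProduct_comm β x]
    field_simp
    ring
  have hbias : ⟪f, φ z⟫ - c ⬝ᵥ (G⁻¹ *ᵥ fun j => ⟪f, φ (p j)⟫) = ⟪f, r⟫ := by
    rw [hsymm, ← hα, hr, inner_sub_right, inner_sum, dotProduct]
    congr 1
    exact Finset.sum_congr rfl fun j _ => by rw [inner_smul_right]
  have hnoise : c ⬝ᵥ (G⁻¹ *ᵥ e) = ⟪r, ψ⟫ + α ⬝ᵥ x := by
    rw [← hβ, hr, inner_sub_left, hψ, inner_sum_feature hφ, inner_sum_feature_sum_feature hφ,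
      ← hK, ← hx, dotProduct_comm]
    ring
  have hsplit : ⟪f, φ z⟫ - c ⬝ᵥ (G⁻¹ *ᵥ fun j => ⟪f, φ (p j)⟫ + e j) =
      ⟪f, r⟫ - (⟪r, ψ⟫ + α ⬝ᵥ x) := by
    rw [← hnoise, ← hbias, show (fun j => ⟪f, φ (p j)⟫ + e j) = (fun j => ⟪f, φ (p j)⟫) + e from rfl,
      Matrix.mulVec_add, dotProduct_add]
    ring
  have hαα : 0 ≤ α ⬝ᵥ α := Finset.sum_nonneg fun j _ => mul_self_nonneg _
  have hxx : 0 ≤ x ⬝ᵥ x := Finset.sum_nonneg fun j _ => mul_self_nonneg _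
  have h1 : |⟪f, r⟫| ≤ ‖f‖ * √(κ z z - c ⬝ᵥ α) := by
    refine (abs_real_inner_le_norm f r).trans (mul_le_mul_of_nonneg_left ?_ (norm_nonneg _))
    refine Real.le_sqrt_of_sq_le ?_
    rw [← hr_sq]
    nlinarith
  have h2 : |⟪r, ψ⟫ + α ⬝ᵥ x| ≤ √(x ⬝ᵥ e / lam) * √(κ z z - c ⬝ᵥ α) := by
    have hαx : |α ⬝ᵥ x| ≤ √(α ⬝ᵥ α) * √(x ⬝ᵥ x) := by
      rw [← Real.sqrt_mul hαα]
      refine Real.abs_le_sqrt ?_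
      have := Finset.sum_mul_sq_le_sq_mul_sq Finset.univ α x
      simpa only [dotProduct, sq] using this
    calc |⟪r, ψ⟫ + α ⬝ᵥ x| ≤ ‖r‖ * ‖ψ‖ + √(α ⬝ᵥ α) * √(x ⬝ᵥ x) :=
          (abs_add_le _ _).trans (add_le_add (abs_real_inner_le_norm r ψ) hαx)
      _ ≤ √(‖r‖ ^ 2 + lam * √(α ⬝ᵥ α) ^ 2) * √(‖ψ‖ ^ 2 + √(x ⬝ᵥ x) ^ 2 / lam) :=
          (le_abs_self _).trans (mul_add_mul_le_sqrt_mul_sqrt hlam _ _ _ _)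
      _ = √(x ⬝ᵥ e / lam) * √(κ z z - c ⬝ᵥ α) := by
          rw [Real.sq_sqrt hαα, Real.sq_sqrt hxx, hr_sq, hψ_sq, mul_comm]
  rw [hsplit, ← Matrix.mulVec_mulVec, ← hβ, ← hx, add_mul]
  exact (abs_sub _ _).trans (add_le_add h1 h2)

end Regression

/-! ### Ville's inequality and the mixture supermartingale of the noise. -/

section Supermartingale

/-- Ville's maximal inequality for nonnegative supermartingales, over a finite horizon. -/
lemma mul_measure_exists_le_of_supermartingale {Ω : Type*} [mΩ : MeasurableSpace Ω]
    {P : Measure Ω} {ℱ : Filtration ℕ mΩ} {M : ℕ → Ω → ℝ≥0∞} {N : ℕ}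
    (hM : ∀ n ≤ N, Measurable[ℱ n] (M n))
    (hstep : ∀ n < N, ∀ B, MeasurableSet[ℱ n] B → ∫⁻ ω in B, M (n + 1) ω ∂P ≤ ∫⁻ ω in B, M n ω ∂P)
    (c : ℝ≥0∞) :
    c * P {ω | ∃ n ≤ N, c ≤ M n ω} ≤ ∫⁻ ω, M 0 ω ∂P := by
  let A : ℕ → Set Ω := fun n => {ω | ∃ i ≤ n, c ≤ M i ω}
  have hlevel : ∀ n ≤ N, MeasurableSet[ℱ n] {ω | c ≤ M n ω} := fun n hn =>
    hM n hn measurableSet_Ici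
  have hA : ∀ n ≤ N, MeasurableSet[ℱ n] (A n) := fun n hn => by
    have : A n = ⋃ i ∈ Finset.range (n + 1), {ω | c ≤ M i ω} := by
      ext ω
      simp [A]
    rw [this]
    refine @Finset.measurableSet_biUnion _ _ (ℱ n) _ _ fun i hi => ?_
    have hin : i ≤ n := Nat.lt_succ_iff.1 (Finset.mem_range.1 hi)
    exact ℱ.mono hin _ (hlevel i (hin.trans hn))
  have hsplit : ∀ n ≤ N, ∀ B : Set Ω, MeasurableSet B →
      c * P (B ∩ {ω | c ≤ M n ω}) + ∫⁻ ω in B \ {ω | c ≤ M n ω}, M n ω ∂P ≤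
        ∫⁻ ω in B, M n ω ∂P := fun n hn B hB => by
    have hl : MeasurableSet {ω | c ≤ M n ω} := ℱ.le n _ (hlevel n hn)
    rw [← lintegral_inter_add_sdiff (M n) B hl]
    gcongr
    rw [← setLIntegral_const]
    exact setLIntegral_mono_ae' (hB.inter hl) (ae_of_all _ fun ω hω => hω.2)
  -- The left side bounds from below the mean of the process stopped on first reaching `c`: at least
  -- `c` where it has stopped, the current value elsewhere.
  have key : ∀ n ≤ N, c * P (A n) + ∫⁻ ω in (A n)ᶜ, M n ω ∂P ≤ ∫⁻ ω, M 0 ω ∂P := by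
    intro n
    induction n with
    | zero =>
      intro h0
      have h := hsplit 0 h0 Set.univ MeasurableSet.univ
      have hA0 : A 0 = {ω | c ≤ M 0 ω} := by
        ext ω
        simp [A]
      rwa [Set.univ_inter, ← Set.compl_eq_univ_sdiff, ← hA0, setLIntegral_univ] at h
    | succ n ih =>
      intro hn
      have hn' : n ≤ N := (Nat.le_succ n).trans hn
      have hAn := ℱ.le n _ (hA n hn')
      have h := hsplit (n + 1) hn (A n)ᶜ hAn.compl
      have hAs : A (n + 1) = A n ∪ ((A n)ᶜ ∩ {ω | c ≤ M (n + 1) ω}) := by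
        rw [Set.union_inter_distrib_left, Set.union_compl_self, Set.univ_inter]
        ext ω
        simp only [A, Set.mem_ofPred_eq, Set.mem_union]
        constructor
        · rintro ⟨i, hi, hc⟩
          rcases Nat.le_succ_iff.1 hi with h | rfl
          · exact Or.inl ⟨i, h, hc⟩
          · exact Or.inr hc
        · rintro (⟨i, hi, hc⟩ | hc)
          · exact ⟨i, hi.trans (Nat.le_succ n), hc⟩
          · exact ⟨n + 1, le_rfl, hc⟩
      have hAc : (A (n + 1))ᶜ = (A n)ᶜ \ {ω | c ≤ M (n + 1) ω} := by
        rw [hAs, Set.union_inter_distrib_left, Set.union_compl_self, Set.univ_inter,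
          Set.compl_union, Set.sdiff_eq]
      calc c * P (A (n + 1)) + ∫⁻ ω in (A (n + 1))ᶜ, M (n + 1) ω ∂P
          ≤ c * (P (A n) + P ((A n)ᶜ ∩ {ω | c ≤ M (n + 1) ω})) +
              ∫⁻ ω in (A n)ᶜ \ {ω | c ≤ M (n + 1) ω}, M (n + 1) ω ∂P := by
            rw [hAc]
            gcongr
            rw [hAs]
            exact measure_union_le _ _
        _ ≤ c * P (A n) + ∫⁻ ω in (A n)ᶜ, M (n + 1) ω ∂P := by
            rw [mul_add, add_assoc]
            gcongr
        _ ≤ c * P (A n) + ∫⁻ ω in (A n)ᶜ, M n ω ∂P := by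
            exact add_le_add le_rfl (hstep n hn _ (MeasurableSet.compl (hA n hn')))
        _ ≤ _ := ih hn'
  exact le_self_add.trans (key N le_rfl)

/-- The compensator `σ² t² / 2` is the sub-Gaussian bound on each log moment generating function,
and independence adds these bounds. -/
lemma lintegral_exp_sum_le_one {Ω ι : Type*} [Fintype ι] [MeasurableSpace Ω] {P : Measure Ω}
    {X : ι → Ω → ℝ} {σ : ℝ≥0} (hX : iIndepFun X P)
    (hsub : ∀ i, HasSubgaussianMGF (X i) (σ ^ 2) P) (t : ι → ℝ) :
    ∫⁻ ω, ENNReal.ofReal (Real.exp (∑ i, (t i * X i ω - σ ^ 2 * t i ^ 2 / 2))) ∂P ≤ 1 := by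
  have hind : iIndepFun (fun i ω => t i * X i ω) P :=
    hX.comp (fun i y => t i * y) fun i => by fun_prop
  have hS := HasSubgaussianMGF.sum_of_iIndepFun hind (s := Finset.univ)
    fun i _ => (hsub i).const_mul (t i)
  have hint := hS.integrable_exp_mul 1
  have hle := hS.mgf_le 1
  simp only [one_mul] at hint
  have h1 : ∀ ω, Real.exp (∑ i, (t i * X i ω - σ ^ 2 * t i ^ 2 / 2)) =
      Real.exp (∑ i, t i * X i ω) * Real.exp (-∑ i, σ ^ 2 * t i ^ 2 / 2) := fun ω => by
    rw [← Real.exp_add, Finset.sum_sub_distrib, sub_eq_add_neg]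
  simp_rw [h1]
  rw [← ofReal_integral_eq_lintegral_ofReal (hint.mul_const _)
    (ae_of_all _ fun ω => by positivity), integral_mul_const]
  refine ENNReal.ofReal_le_one.2 ?_
  have h2 : ∫ ω, Real.exp (∑ i, t i * X i ω) ∂P ≤ Real.exp (∑ i, σ ^ 2 * t i ^ 2 / 2) := by
    refine (le_of_eq ?_).trans (hle.trans_eq ?_)
    · simp [mgf]
    · congr 1
      rw [NNReal.coe_sum, Finset.sum_mul, Finset.sum_div]
      refine Finset.sum_congr rfl fun i _ => ?_
      change t i ^ 2 * (σ : ℝ) ^ 2 * 1 ^ 2 / 2 = _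
      ring
  calc _ ≤ Real.exp (∑ i, σ ^ 2 * t i ^ 2 / 2) * Real.exp (-∑ i, σ ^ 2 * t i ^ 2 / 2) := by
        gcongr
    _ = 1 := by rw [← Real.exp_add, add_neg_cancel, Real.exp_zero]

lemma measurable_section {Ω E : Type*} {m₀ : MeasurableSpace Ω} [MeasurableSpace E]
    {f : Ω → E → ℝ≥0∞} (hf : Measurable fun q : Ω × E => f q.1 q.2) (v : E) :
    Measurable fun ω => f ω v :=
  hf.comp (measurable_id.prodMk measurable_const)

/-- Conditioning without conditional expectations: split according to the finitely many values of
`x`. On each piece the decision is frozen, so the factor in `e` is independent of the rest and has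
mean at most `1`. -/
lemma setLIntegral_mul_le_of_indep {X Ω E : Type*} [Finite X] {m₀ : MeasurableSpace Ω}
    [mΩ : MeasurableSpace Ω] [MeasurableSpace E] {P : Measure Ω} (hm : m₀ ≤ mΩ) {e : Ω → E}
    (he : Measurable e) (hind : Indep (MeasurableSpace.comap e inferInstance) m₀ P)
    {x : Ω → X} (hx : ∀ a, MeasurableSet[m₀] {ω | x ω = a})
    {R : Ω → ℝ≥0∞} (hR : Measurable[m₀] R) {Y : X → E → ℝ≥0∞} (hY : ∀ a, Measurable (Y a))
    (hY_le : ∀ a, ∫⁻ ω, Y a (e ω) ∂P ≤ 1) {B : Set Ω} (hB : MeasurableSet[m₀] B) :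
    ∫⁻ ω in B, R ω * Y (x ω) (e ω) ∂P ≤ ∫⁻ ω in B, R ω ∂P := by
  classical
  have := Fintype.ofFinite X
  let S : X → Ω → ℝ≥0∞ := fun a => (B ∩ {ω | x ω = a}).indicator R
  have hS : ∀ a, Measurable[m₀] (S a) := fun a =>
    Measurable.indicator (m := m₀) hR (MeasurableSet.inter (m := m₀) hB (hx a))
  have hSm : ∀ a, Measurable (S a) := fun a => (hS a).mono hm le_rfl
  have hYm : ∀ a, Measurable fun ω => Y a (e ω) := fun a => (hY a).comp he
  have hdecomp : ∀ f : X → Ω → ℝ≥0∞, ∀ ω,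
      B.indicator (fun ω => R ω * f (x ω) ω) ω = ∑ a, S a ω * f a ω := fun f ω => by
    rw [Finset.sum_eq_single (x ω)]
    · by_cases hω : ω ∈ B
      · have h1 : S (x ω) ω = R ω := Set.indicator_of_mem (s := B ∩ {ω' | x ω' = x ω}) ⟨hω, rfl⟩ R
        rw [Set.indicator_of_mem hω, h1]
      · have h1 : S (x ω) ω = 0 :=
          Set.indicator_of_notMem (s := B ∩ {ω' | x ω' = x ω}) (fun h => hω h.1) R
        rw [Set.indicator_of_notMem hω, h1, zero_mul]
    · intro a _ ha
      have h1 : S a ω = 0 :=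
        Set.indicator_of_notMem (s := B ∩ {ω' | x ω' = a}) (fun h => ha h.2.symm) R
      rw [h1, zero_mul]
    · simp
  have hone : ∀ ω, B.indicator R ω = ∑ a, S a ω := fun ω => by
    simpa using hdecomp (fun _ _ => 1) ω
  rw [← lintegral_indicator (hm _ hB), ← lintegral_indicator (hm _ hB),
    lintegral_congr (hdecomp fun a ω => Y a (e ω)), lintegral_congr hone,
    lintegral_finsetSum _ fun a _ => hSm a,
    lintegral_finsetSum _ fun a _ => (hSm a).fun_mul (hYm a)]
  refine Finset.sum_le_sum fun a _ => ?_
  refine (lintegral_mul_eq_lintegral_mul_lintegral_of_independent_measurableSpace hm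
    (measurable_iff_comap_le.1 he) hind.symm (hS a)
    ((hY a).comp (comap_measurable e))).trans_le ?_
  exact mul_le_of_le_one_right zero_le (hY_le a)

variable {X Ω : Type*} {T m : ℕ}

/-- The likelihood factor of the observations of iteration `j`. -/
def stepLikelihood (lam s : ℝ) (x : Fin (T + 1) → Ω → X) (ε : Fin (T + 1) → Fin (m + 1) → Ω → ℝ)
    (j : Fin (T + 1)) (ω : Ω) (v : EuclideanSpace ℝ (Point X T m)) : ℝ≥0∞ :=
  likelihood lam (fun i => (x j ω, j, i)) (fun i => s * ε j i ω) v

/-- The likelihood of the observations of all iterations before `n`. -/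
def runLikelihood (lam s : ℝ) (x : Fin (T + 1) → Ω → X) (ε : Fin (T + 1) → Fin (m + 1) → Ω → ℝ)
    (n : ℕ) (ω : Ω) (v : EuclideanSpace ℝ (Point X T m)) : ℝ≥0∞ :=
  ∏ j ∈ Finset.univ.filter (fun j : Fin (T + 1) => (j : ℕ) < n), stepLikelihood lam s x ε j ω v

lemma runLikelihood_succ (lam s : ℝ) (x : Fin (T + 1) → Ω → X)
    (ε : Fin (T + 1) → Fin (m + 1) → Ω → ℝ) (j : Fin (T + 1)) (ω : Ω)
    (v : EuclideanSpace ℝ (Point X T m)) :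
    runLikelihood lam s x ε (j + 1) ω v =
      runLikelihood lam s x ε j ω v * stepLikelihood lam s x ε j ω v := by
  have : (Finset.univ.filter fun i : Fin (T + 1) => (i : ℕ) < (j : ℕ) + 1) =
      insert j (Finset.univ.filter fun i : Fin (T + 1) => (i : ℕ) < j) := by
    ext i
    simp only [Finset.mem_filter, Finset.mem_univ, true_and, Finset.mem_insert, Fin.ext_iff]
    omega
  rw [runLikelihood, this, Finset.prod_insert (by simp), mul_comm, runLikelihood]

/-- This identifies the mixture supermartingale with the Gaussian integral that has a closed form.
-/
lemma lintegral_runLikelihood [Fintype X] [DecidableEq X]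
    (κ : Matrix (Point X T m) (Point X T m) ℝ) (lam s : ℝ)
    (x : Fin (T + 1) → Ω → X) (ε : Fin (T + 1) → Fin (m + 1) → Ω → ℝ) (k : Fin (T + 1)) (ω : Ω) :
    ∫⁻ v, runLikelihood lam s x ε k ω v ∂(multivariateGaussian 0 κ) =
      evidence κ lam (Setup.dataPoint (m := m) (fun j => x j ω) k)
        (fun q => s * ε q.1 q.2 ω) := by
  refine lintegral_congr fun v => ?_
  simp only [runLikelihood, stepLikelihood, likelihood, Setup.dataPoint]
  rw [← ENNReal.ofReal_prod_of_nonneg fun j _ => (Real.exp_pos _).le, ← Real.exp_sum,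
    Fintype.sum_prod_type]
  congr 2
  exact Finset.sum_subtype _ (by simp) _

variable [Finite X]

lemma measurable_stepLikelihood [MeasurableSpace Ω] (lam s : ℝ) {x : Fin (T + 1) → Ω → X}
    {ε : Fin (T + 1) → Fin (m + 1) → Ω → ℝ} (j : Fin (T + 1))
    (hx : ∀ a, MeasurableSet {ω | x j ω = a}) (hε : ∀ i, Measurable (ε j i)) :
    Measurable fun q : Ω × EuclideanSpace ℝ (Point X T m) =>
      stepLikelihood lam s x ε j q.1 q.2 := by
  classical
  have := Fintype.ofFinite X
  have hv : ∀ i, Measurable fun q : Ω × EuclideanSpace ℝ (Point X T m) => q.2 (x j q.1, j, i) := by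
    intro i
    -- Evaluation at a random decision is a finite sum over the possible decisions.
    have : (fun q : Ω × EuclideanSpace ℝ (Point X T m) => q.2 (x j q.1, j, i)) =
        fun q => ∑ a, if x j q.1 = a then q.2 (a, j, i) else 0 := by
      ext q
      simp
    rw [this]
    refine Finset.measurable_sum _ fun a _ => Measurable.ite ?_ (by fun_prop) measurable_const
    exact measurable_fst (hx a)
  unfold stepLikelihood likelihood
  refine (Real.measurable_exp.comp (Finset.measurable_fun_sum _ fun i _ => ?_)).ennreal_ofReal
  exact (((((hε i).comp measurable_fst).const_mul s).mul (hv i)).sub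
    (((hv i).pow_const 2).div_const 2)).div_const lam

lemma measurable_runLikelihood [MeasurableSpace Ω] (lam s : ℝ) {x : Fin (T + 1) → Ω → X}
    {ε : Fin (T + 1) → Fin (m + 1) → Ω → ℝ} (n : ℕ)
    (hx : ∀ j : Fin (T + 1), (j : ℕ) < n → ∀ a, MeasurableSet {ω | x j ω = a})
    (hε : ∀ j : Fin (T + 1), (j : ℕ) < n → ∀ i, Measurable (ε j i)) :
    Measurable fun q : Ω × EuclideanSpace ℝ (Point X T m) =>
      runLikelihood lam s x ε n q.1 q.2 := by
  unfold runLikelihood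
  refine Finset.measurable_fun_prod _ fun j hj => ?_
  have hj' : (j : ℕ) < n := (Finset.mem_filter.1 hj).2
  exact measurable_stepLikelihood lam s j (hx j hj') (hε j hj')

namespace IsNoisySampling

variable [mΩ : MeasurableSpace Ω] {P : Measure Ω} {ℱ : Filtration ℕ mΩ} {σ : ℝ≥0}
  {x : Fin (T + 1) → Ω → X} {ε : Fin (T + 1) → Fin (m + 1) → Ω → ℝ}

/-- Only iterations `j < n` enter: their noise is known at `j + 1 ≤ n`. -/
lemma measurable_runLikelihood_filtration (h : IsNoisySampling P ℱ σ x ε) (lam s : ℝ) (n : ℕ) :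
    Measurable[(ℱ n).prod inferInstance] fun q : Ω × EuclideanSpace ℝ (Point X T m) =>
      runLikelihood lam s x ε n q.1 q.2 :=
  @measurable_runLikelihood X Ω T m _ (ℱ n) lam s x ε n
    (fun j hj a => ℱ.mono hj.le _ (h.decision_measurable j a))
    (fun j hj i => (h.noise_measurable j i).mono (ℱ.mono hj) le_rfl)

/-- The supermartingale step for one fixed `v`. With `s² σ² = lam` the quadratic term of the
likelihood is exactly the sub-Gaussian compensator of the linear one. -/
lemma setLIntegral_runLikelihood_succ_le (h : IsNoisySampling P ℱ σ x ε) {lam s : ℝ}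
    (hlam : 0 < lam) (hs : s ^ 2 * σ ^ 2 = lam) (j : Fin (T + 1)) {B : Set Ω}
    (hB : MeasurableSet[ℱ j] B) (v : EuclideanSpace ℝ (Point X T m)) :
    ∫⁻ ω in B, runLikelihood lam s x ε (j + 1) ω v ∂P ≤
      ∫⁻ ω in B, runLikelihood lam s x ε j ω v ∂P := by
  have hεm : Measurable fun ω i => ε j i ω :=
    measurable_pi_lambda _ fun i => (h.noise_measurable j i).mono (ℱ.le _) le_rfl
  have hR : Measurable[ℱ j] fun ω => runLikelihood lam s x ε j ω v :=
    measurable_section (f := fun ω v => runLikelihood lam s x ε j ω v)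
      (h.measurable_runLikelihood_filtration lam s j) v
  let Y : X → (Fin (m + 1) → ℝ) → ℝ≥0∞ := fun a e =>
    likelihood lam (fun i => (a, j, i)) (fun i => s * e i) v
  have hY : ∀ a, Measurable (Y a) := fun a => by
    simp only [Y, likelihood]
    fun_prop
  have hY_le : ∀ a, ∫⁻ ω, Y a (fun i => ε j i ω) ∂P ≤ 1 := fun a => by
    have hind : iIndepFun (ε j) P :=
      h.noise_indep.precomp (g := fun i : Fin (m + 1) => (j, i)) (Prod.mk_right_injective j)
    refine (lintegral_congr fun ω => ?_).trans_le (lintegral_exp_sum_le_one hind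
      (fun i => h.noise_subGaussian j i) fun i => s * v (a, j, i) / lam)
    simp only [Y, likelihood]
    congr 2
    refine Finset.sum_congr rfl fun i _ => ?_
    have : (σ : ℝ) ^ 2 * (s * v (a, j, i) / lam) ^ 2 =
        (s ^ 2 * σ ^ 2) * v (a, j, i) ^ 2 / lam ^ 2 := by
      ring
    rw [this, hs]
    field_simp
  have key := setLIntegral_mul_le_of_indep (x := x j) (Y := Y) (ℱ.le j) hεm
    (h.noise_indep_past j) (h.decision_measurable j) hR hY hY_le hB
  refine (lintegral_congr fun ω => ?_).trans_le key
  exact runLikelihood_succ lam s x ε j ω v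

lemma measurable_evidence [Fintype X] [DecidableEq X] (h : IsNoisySampling P ℱ σ x ε)
    (κ : Matrix (Point X T m) (Point X T m) ℝ) (lam s : ℝ) (k : Fin (T + 1)) :
    Measurable fun ω => evidence κ lam (Setup.dataPoint (m := m) (fun j => x j ω) k)
      (fun q => s * ε q.1 q.2 ω) := by
  simp_rw [← lintegral_runLikelihood]
  exact Measurable.lintegral_prod_right' (f := fun q : Ω × EuclideanSpace ℝ (Point X T m) =>
    runLikelihood lam s x ε k q.1 q.2)
    (measurable_runLikelihood lam s k (fun j _ a => ℱ.le _ _ (h.decision_measurable j a))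
      (fun j _ i => (h.noise_measurable j i).mono (ℱ.le _) le_rfl))

/-- The evidence of the noise, as a function of time, rarely exceeds `1 / δ`. -/
lemma measure_exists_le_evidence_le [Fintype X] [DecidableEq X] [IsProbabilityMeasure P]
    (h : IsNoisySampling P ℱ σ x ε)
    (κ : Matrix (Point X T m) (Point X T m) ℝ) {lam s : ℝ} (hlam : 0 < lam)
    (hs : s ^ 2 * σ ^ 2 = lam) (c : ℝ≥0∞) :
    c * P {ω | ∃ k : Fin (T + 1), c ≤ evidence κ lam
      (Setup.dataPoint (m := m) (fun j => x j ω) k) (fun q => s * ε q.1 q.2 ω)} ≤ 1 := by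
  let M : ℕ → Ω → ℝ≥0∞ := fun n ω =>
    ∫⁻ v, runLikelihood lam s x ε n ω v ∂(multivariateGaussian 0 κ)
  have hM : ∀ n ≤ T, Measurable[ℱ n] (M n) := fun n _ =>
    @Measurable.lintegral_prod_right' _ _ (ℱ n) _ _ _ _
      (h.measurable_runLikelihood_filtration lam s n)
  have hjoint : ∀ n, Measurable fun q : Ω × EuclideanSpace ℝ (Point X T m) =>
      runLikelihood lam s x ε n q.1 q.2 := fun n =>
    measurable_runLikelihood lam s n (fun j _ a => ℱ.le _ _ (h.decision_measurable j a))
      (fun j _ i => (h.noise_measurable j i).mono (ℱ.le _) le_rfl)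
  have hville := mul_measure_exists_le_of_supermartingale (P := P) (c := c) hM
    fun n hn B hB => by
      have hBm : MeasurableSet B := ℱ.le _ _ hB
      simp only [M]
      -- By Tonelli the step inequality for each `v` passes to the average over the prior.
      rw [lintegral_lintegral_swap (f := fun ω v => runLikelihood lam s x ε (n + 1) ω v)
          (hjoint _).aemeasurable,
        lintegral_lintegral_swap (f := fun ω v => runLikelihood lam s x ε n ω v)
          (hjoint _).aemeasurable]
      exact lintegral_mono fun v =>
        h.setLIntegral_runLikelihood_succ_le hlam hs ⟨n, by omega⟩ hB v
  have hM0 : ∫⁻ ω, M 0 ω ∂P = 1 := by simp [M, runLikelihood]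
  rw [hM0] at hville
  refine le_trans ?_ hville
  gcongr
  rintro ⟨k, hk⟩
  refine ⟨k, Nat.lt_succ_iff.1 k.2, ?_⟩
  rwa [← lintegral_runLikelihood] at hk

end IsNoisySampling

end Supermartingale

/-! ### Safety from valid confidence intervals, and validity from small noise energy. -/

namespace Setup

variable {X : Type*} {T m : ℕ} (A : Setup X T m)
  (x : Fin (T + 1) → X) (y : Fin (T + 1) → Fin (m + 1) → ℝ)

lemma confC_succ (t : Fin T) (a : X) (i : Fin (m + 1)) :
    A.confC x y t.succ a i =
      (A.confC x y t.castSucc a i + Set.Icc (-A.lipT t.castSucc) (A.lipT t.castSucc)) ∩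
        A.confQ x y t.succ a i := by
  simp only [confC, Fin.induction_succ]

variable {A x y}

/-- Induction on time: widening by `L(k-1)` absorbs the drift of the function, and the seed
condition starts the induction. -/
lemma apply_mem_confC {h : Point X T m → ℝ}
    (h_lipT : ∀ (t : Fin T) a i,
      |h (a, t.succ, i) - h (a, t.castSucc, i)| ≤ A.lipT t.castSucc)
    (h_seed : ∀ a ∈ A.seed, ∀ i : Fin m, A.lipT 0 ≤ h (a, 0, i.succ))
    (hQ : ∀ (t : Fin T) a i, h (a, t.succ, i) ∈ A.confQ x y t.succ a i)
    (k : Fin (T + 1)) (a : X) (i : Fin (m + 1)) : h (a, k, i) ∈ A.confC x y k a i := by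
  induction k using Fin.induction with
  | zero =>
    intro ha hi
    obtain ⟨j, rfl⟩ := Fin.exists_succ_eq.2 hi
    exact h_seed a ha j
  | succ t ih =>
    rw [confC_succ]
    refine ⟨Set.mem_add.2 ⟨_, ih, h (a, t.succ, i) - h (a, t.castSucc, i),
      abs_le.1 (h_lipT t a i), by ring⟩, hQ t a i⟩

/-- If the confidence intervals contain the unknown function, the safe sets are safe. -/
lemma nonneg_of_mem_safeSet [MetricSpace X] {h : Point X T m → ℝ}
    (h_lipX : ∀ t i, LipschitzWith A.lipX (fun a => h (a, t, i)))
    (hL : ∀ t, 0 ≤ A.lipT t)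
    (h_lipT : ∀ (t : Fin T) a i,
      |h (a, t.succ, i) - h (a, t.castSucc, i)| ≤ A.lipT t.castSucc)
    (h_seed : ∀ a ∈ A.seed, ∀ i : Fin m, A.lipT 0 ≤ h (a, 0, i.succ))
    (hQ : ∀ (t : Fin T) a i, h (a, t.succ, i) ∈ A.confQ x y t.succ a i)
    {k : Fin (T + 1)} {a : X} (ha : a ∈ A.safeSet x y k) (i : Fin m) :
    0 ≤ h (a, k, i.succ) := by
  cases k using Fin.cases with
  | zero => exact (hL 0).trans (h_seed a ha i)
  | succ t =>
    simp only [safeSet, Fin.induction_succ] at ha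
    obtain ⟨b, -, hb⟩ := ha i
    have hC := apply_mem_confC h_lipT h_seed hQ t.succ b i.succ
    -- `sInf` is a genuine lower bound only for sets bounded below; from iteration `1` on, `Q_k`
    -- provides this, whereas `C_0` may be the whole line.
    have hbdd : BddBelow (A.confC x y t.succ b i.succ) := by
      rw [confC_succ]
      exact bddBelow_Icc.mono Set.inter_subset_right
    have hlow : A.lower x y t.succ b i.succ ≤ h (b, t.succ, i.succ) := csInf_le hbdd hC
    have hlip := (h_lipX t.succ i.succ).dist_le_mul b a
    rw [Real.dist_eq] at hlip
    have := (abs_le.1 hlip).2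
    have := hL t.succ
    linarith

/-- Repeated decisions do no harm, since different iterations have different times. -/
lemma dataPoint_injective (k : Fin (T + 1)) :
    Function.Injective (dataPoint (m := m) x k) := by
  rintro ⟨j, i⟩ ⟨j', i'⟩ hjj
  simp only [dataPoint, Prod.mk.injEq] at hjj
  exact Prod.ext (Subtype.ext hjj.2.1) hjj.2.2

/-- There are `k (m + 1)` observations, at distinct points with times below `k ≤ k (m + 1)`, so they
are admissible in the information capacity. -/
lemma neg_log_evidence_dataPoint_le [Fintype X] [DecidableEq X] (hκ : A.kernel.PosSemidef)
    (hvar : 0 < A.modelVar) (k : Fin (T + 1)) :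
    -Real.log (evidence A.kernel A.modelVar (dataPoint (m := m) x k) 0).toReal ≤
      infoCapacity A.kernel A.modelVar (k * (m + 1)) := by
  refine neg_log_evidence_le_infoCapacity hκ hvar ?_ _ (dataPoint_injective k) fun q => ?_
  · rw [Fintype.card_prod, Fintype.card_fin, Fintype.card_subtype]
    have : (Finset.univ.filter fun j => j < k) = Finset.Iio k := by
      ext j
      simp
    rw [this, Fin.card_Iio]
  · exact (show ((q.1 : Fin (T + 1)) : ℕ) < k from q.1.2).trans_le
      (Nat.le_mul_of_pos_right _ (Nat.succ_pos m))

/-- The energy of the noise, in the norm given by the covariance of the data. -/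
def noiseEnergy (A : Setup X T m) (x : Fin (T + 1) → X) (k : Fin (T + 1))
    (e : DataIdx T m k → ℝ) : ℝ :=
  (((A.kernel.submatrix (dataPoint x k) (dataPoint x k)) * (A.gram x k)⁻¹) *ᵥ e) ⬝ᵥ e

/-- The kernel sections serve as feature map: their Gram matrix is the kernel, and pairing with them
evaluates `h`. -/
lemma apply_mem_confQ (hκ : A.kernel.PosSemidef) (hvar : 0 < A.modelVar)
    {H : Type*} [NormedAddCommGroup H] [InnerProductSpace ℝ H] [CompleteSpace H]
    [RKHS ℝ H (Point X T m) ℝ] (hH : ∀ z z', RKHS.kernel H z z' 1 = A.kernel z z') (h : H)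
    {e : Fin (T + 1) → Fin (m + 1) → ℝ} (hy : ∀ k i, y k i = h (x k, k, i) + e k i)
    {k : Fin (T + 1)}
    (hβ : ‖h‖ + √(A.noiseEnergy x k (fun q => e q.1 q.2) / A.modelVar) ≤ A.sqrtBeta k)
    (a : X) (i : Fin (m + 1)) : h (a, k, i) ∈ A.confQ x y k a i := by
  have hφ : ∀ z z', inner ℝ (RKHS.kerFun H z (1 : ℝ)) (RKHS.kerFun H z' (1 : ℝ)) = A.kernel z z' :=
    fun z z' => by
      rw [RKHS.kerFun_inner, RKHS.kerFun_apply, hH]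
      simp
  have hf : ∀ z, inner ℝ h (RKHS.kerFun H z (1 : ℝ)) = h z := fun z => by
    rw [RKHS.inner_kerFun]
    simp
  have key := abs_sub_posterior_mean_le (φ := fun z => RKHS.kerFun H z (1 : ℝ)) hφ hκ hvar
    (dataPoint (m := m) x k) (a, k, i) h (fun q => e q.1 q.2)
  simp only [hf] at key
  have hmean : A.postMean x y k a i = (fun q => A.kernel (dataPoint x k q) (a, k, i)) ⬝ᵥ
      ((A.kernel.submatrix (dataPoint x k) (dataPoint x k) + A.modelVar • 1)⁻¹ *ᵥ
        fun q => h (dataPoint x k q) + e q.1 q.2) := by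
    simp only [postMean, hy]
    rfl
  rw [← hmean] at key
  have hle : |h (a, k, i) - A.postMean x y k a i| ≤ A.sqrtBeta k * A.postStd x k a i :=
    key.trans (mul_le_mul_of_nonneg_right hβ (Real.sqrt_nonneg _))
  rw [abs_le] at hle
  exact ⟨by linarith [hle.1], by linarith [hle.2]⟩

/-- Take logarithms in the closed form of the evidence. The scaling by `√λ / σ` turns the energy
over `2 λ` into the energy of the unscaled noise over `2 σ²`. -/
lemma noiseEnergy_lt [Fintype X] [DecidableEq X] (hκ : A.kernel.PosSemidef)
    (hvar : 0 < A.modelVar) {σ : ℝ} (hσ : 0 < σ) {δ : ℝ} (hδ : 0 < δ) {k : Fin (T + 1)}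
    {e : DataIdx T m k → ℝ}
    (he : evidence A.kernel A.modelVar (dataPoint x k) (fun q => √A.modelVar / σ * e q) <
      ENNReal.ofReal (1 / δ)) :
    A.noiseEnergy x k e <
      2 * σ ^ 2 * (infoCapacity A.kernel A.modelVar (k * (m + 1)) + Real.log (1 / δ)) := by
  set D := evidence A.kernel A.modelVar (dataPoint (m := m) x k) 0 with hD
  have hD_top : D ≠ ∞ := evidence_ne_top hκ hvar _ _
  have hD_pos : 0 < D.toReal := ENNReal.toReal_pos (evidence_pos _ _ _ _).ne' hD_top
  have hγ := neg_log_evidence_dataPoint_le (x := x) hκ hvar k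
  rw [evidence_eq_exp_inv hκ hvar, ← hD, ← ENNReal.ofReal_toReal hD_top,
    ← ENNReal.ofReal_mul ENNReal.toReal_nonneg, ENNReal.ofReal_lt_ofReal_iff (by positivity)] at he
  have hlog := Real.log_lt_log (mul_pos hD_pos (Real.exp_pos _)) he
  rw [Real.log_mul hD_pos.ne' (Real.exp_pos _).ne', Real.log_exp] at hlog
  have hsmul : (fun q => √A.modelVar / σ * e q) = (√A.modelVar / σ) • e := rfl
  have hq : ((A.kernel.submatrix (dataPoint x k) (dataPoint x k) *
      (A.kernel.submatrix (dataPoint x k) (dataPoint x k) + A.modelVar • 1)⁻¹) *ᵥ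
        fun q => √A.modelVar / σ * e q) ⬝ᵥ (fun q => √A.modelVar / σ * e q) / (2 * A.modelVar) =
      A.noiseEnergy x k e / (2 * σ ^ 2) := by
    rw [hsmul, Matrix.mulVec_smul, smul_dotProduct, dotProduct_smul, smul_eq_mul, smul_eq_mul]
    change √A.modelVar / σ * (√A.modelVar / σ * A.noiseEnergy x k e) / (2 * A.modelVar) = _
    field_simp
    rw [Real.sq_sqrt hvar.le, mul_comm]
  rw [hq] at hlog
  have h1 : A.noiseEnergy x k e / (2 * σ ^ 2) <
      infoCapacity A.kernel A.modelVar (k * (m + 1)) + Real.log (1 / δ) := by linarith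
  rwa [div_lt_iff₀' (by positivity)] at h1

lemma infoCapacity_nonneg [Fintype X] [DecidableEq X] (A : Setup X T m) (n : ℕ) :
    0 ≤ infoCapacity A.kernel A.modelVar n :=
  Real.iSup_nonneg fun _ => ENNReal.toReal_nonneg

end Setup

/-- With high probability the energy of the noise stays below its confidence bound. -/
lemma IsNoisySampling.exists_noiseEnergy_le {X Ω : Type*} [Fintype X] [DecidableEq X] {T m : ℕ}
    [mΩ : MeasurableSpace Ω] {P : Measure Ω} [IsProbabilityMeasure P] {ℱ : Filtration ℕ mΩ}
    {σ : ℝ≥0} {x : Fin (T + 1) → Ω → X} {ε : Fin (T + 1) → Fin (m + 1) → Ω → ℝ}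
    (h : IsNoisySampling P ℱ σ x ε) (A : Setup X T m) (hκ : A.kernel.PosSemidef)
    (hvar : 0 < A.modelVar) {δ : ℝ} (hδ0 : 0 < δ) :
    ∃ E : Set Ω, MeasurableSet E ∧ 1 - δ ≤ P.real E ∧ ∀ ω ∈ E, ∀ k : Fin (T + 1),
      A.noiseEnergy (fun k => x k ω) k (fun q => ε q.1 q.2 ω) ≤
        2 * σ ^ 2 * (infoCapacity A.kernel A.modelVar (k * (m + 1)) + Real.log (1 / δ)) := by
  have hεm : ∀ k i, Measurable (ε k i) := fun k i =>
    (h.noise_measurable k i).mono (ℱ.le _) le_rfl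
  -- For `σ = 0` rescaling is impossible, but the noise vanishes almost surely.
  rcases eq_or_ne σ 0 with rfl | hσ
  · have hE : MeasurableSet {ω | ∀ k i, ε k i ω = 0} := by
      simp only [Set.ofPred_forall]
      exact MeasurableSet.iInter fun k => MeasurableSet.iInter fun i =>
        hεm k i (measurableSet_singleton 0)
    refine ⟨{ω | ∀ k i, ε k i ω = 0}, hE, ?_, fun ω hω k => ?_⟩
    · have h0 : ∀ᵐ ω ∂P, ∀ k i, ε k i ω = 0 := by
        refine ae_all_iff.2 fun k => ae_all_iff.2 fun i => ?_
        have := h.noise_subGaussian k i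
        rw [zero_pow two_ne_zero] at this
        exact this.ae_eq_zero_of_hasSubgaussianMGF_zero
      rw [measureReal_def, (mem_ae_iff_prob_eq_one hE).1 h0, ENNReal.toReal_one]
      linarith
    · have : (fun q : Setup.DataIdx T m k => ε q.1 q.2 ω) = 0 := by
        ext q
        exact hω _ _
      rw [this, Setup.noiseEnergy]
      simp
  · have hσ' : (0 : ℝ) < σ := NNReal.coe_pos.2 (pos_iff_ne_zero.2 hσ)
    -- Scales the noise to variance proxy `modelVar`, matching the Gaussian model.
    set s : ℝ := √A.modelVar / σ with hs
    let D : Fin (T + 1) → Ω → ℝ≥0∞ := fun k ω => evidence A.kernel A.modelVar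
      (Setup.dataPoint (m := m) (fun j => x j ω) k) (fun q => s * ε q.1 q.2 ω)
    have hDm : ∀ k, Measurable (D k) := fun k => h.measurable_evidence A.kernel A.modelVar s k
    set c := ENNReal.ofReal (1 / δ) with hc
    have hs2 : s ^ 2 * (σ : ℝ) ^ 2 = A.modelVar := by
      rw [hs, div_pow, Real.sq_sqrt hvar.le]
      field_simp
    have hville := h.measure_exists_le_evidence_le A.kernel hvar hs2 c
    have hBm : MeasurableSet {ω | ∃ k, c ≤ D k ω} := by
      simp only [Set.ofPred_exists]
      exact MeasurableSet.iUnion fun k => hDm k measurableSet_Ici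
    refine ⟨{ω | ∃ k, c ≤ D k ω}ᶜ, hBm.compl, ?_, fun ω hω k => ?_⟩
    · have hP : P.real {ω | ∃ k, c ≤ D k ω} ≤ δ := by
        have := ENNReal.toReal_mono ENNReal.one_ne_top hville
        have hc_toReal : c.toReal = δ⁻¹ := by
          rw [hc, one_div, ENNReal.toReal_ofReal (by positivity)]
        rw [ENNReal.toReal_mul, hc_toReal, ENNReal.toReal_one, inv_mul_le_iff₀ hδ0, mul_one] at this
        exact this
      rw [probReal_compl_eq_one_sub hBm]
      linarith
    · have hlt : D k ω < c := not_le.1 fun hle => hω ⟨k, hle⟩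
      exact (Setup.noiseEnergy_lt hκ hvar hσ' hδ0 hlt).le

end TVSafeOpt

end

theorem theorem1
    {X : Type*} [Fintype X] [DecidableEq X] [MetricSpace X] {T m : ℕ}
    (A : TVSafeOpt.Setup X T m)
    -- the kernel, and the Hilbert space `H` of functions that it reproduces
    (hκ_psd : A.kernel.PosSemidef) (hκ_le : ∀ z, A.kernel z z ≤ 1)
    {H : Type*} [NormedAddCommGroup H] [InnerProductSpace ℝ H] [CompleteSpace H]
    [RKHS ℝ H (TVSafeOpt.Point X T m) ℝ]
    (hH : ∀ z z', RKHS.kernel H z z' 1 = A.kernel z z')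
    -- the unknown function: bounded norm, Lipschitz in decisions, bounded variation in time
    (h : H) (B : ℝ) (hB : ‖h‖ ≤ B)
    (h_lipX : ∀ t i, LipschitzWith A.lipX (fun a => h (a, t, i)))
    (hL : ∀ t, 0 ≤ A.lipT t)
    (h_lipT : ∀ (t : Fin T) a i,
      |h (a, t.succ, i) - h (a, t.castSucc, i)| ≤ A.lipT t.castSucc)
    -- the safe seed
    (h_seed : ∀ a ∈ A.seed, ∀ i : Fin m,
      0 < h (a, 0, i.succ) ∧ A.lipT 0 ≤ h (a, 0, i.succ))
    -- the model noise variance and the scaling of the confidence intervals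
    (hvar : 1 ≤ A.modelVar) (σ : ℝ≥0) (δ : ℝ) (hδ0 : 0 < δ) (hδ1 : δ < 1)
    (hβ : ∀ k : Fin (T + 1), A.sqrtBeta k = B + σ * √(2 *
      (TVSafeOpt.infoCapacity A.kernel A.modelVar (k * (m + 1)) + 1 + Real.log (1 / δ))))
    -- the random run of the algorithm
    {Ω : Type*} [mΩ : MeasurableSpace Ω] (P : Measure Ω) [IsProbabilityMeasure P]
    (ℱ : Filtration ℕ mΩ) (x : Fin (T + 1) → Ω → X)
    (ε y : Fin (T + 1) → Fin (m + 1) → Ω → ℝ)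
    (h_noise : TVSafeOpt.IsNoisySampling P ℱ σ x ε)
    (hy : ∀ k i ω, y k i ω = h (x k ω, k, i) + ε k i ω)
    (h_run : ∀ ω, A.IsRun (fun k => x k ω) (fun k i => y k i ω)) :
    ∃ E : Set Ω, MeasurableSet E ∧ 1 - δ ≤ P.real E ∧
      ∀ ω ∈ E, ∀ k : Fin (T + 1), ∀ a ∈ A.safeSet (fun k => x k ω) (fun k i => y k i ω) k,
        ∀ i : Fin m, 0 ≤ h (a, k, i.succ) := by
  have hvar0 : 0 < A.modelVar := one_pos.trans_le hvar
  obtain ⟨E, hEm, hEP, hE⟩ := h_noise.exists_noiseEnergy_le A hκ_psd hvar0 hδ0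
  refine ⟨E, hEm, hEP, fun ω hω k a ha i => ?_⟩
  refine TVSafeOpt.Setup.nonneg_of_mem_safeSet h_lipX hL h_lipT
    (fun a ha i => (h_seed a ha i).2) (fun t a i => ?_) ha i
  refine TVSafeOpt.Setup.apply_mem_confQ hκ_psd hvar0 hH h (fun k i => hy k i ω) ?_ a i
  rw [hβ]
  refine add_le_add hB ?_
  set γ := TVSafeOpt.infoCapacity A.kernel A.modelVar ((t.succ : Fin (T + 1)) * (m + 1))
  have hγ : 0 ≤ γ := A.infoCapacity_nonneg _
  have hlog : 0 ≤ Real.log (1 / δ) := Real.log_nonneg (by rw [le_div_iff₀ hδ0]; linarith)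
  have hσ2 : (0 : ℝ) ≤ σ ^ 2 := by positivity
  refine Real.sqrt_le_iff.2 ⟨by positivity, ?_⟩
  rw [mul_pow, Real.sq_sqrt (by positivity), div_le_iff₀ hvar0]
  -- The `+ 1` in the confidence scaling is slack here, and `modelVar ≥ 1` absorbs the division of
  -- the energy by `modelVar`.
  calc _ ≤ 2 * σ ^ 2 * (γ + Real.log (1 / δ)) := hE ω hω t.succ
    _ ≤ σ ^ 2 * (2 * (γ + 1 + Real.log (1 / δ))) := by nlinarith
    _ ≤ σ ^ 2 * (2 * (γ + 1 + Real.log (1 / δ))) * A.modelVar :=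
      le_mul_of_one_le_right (by positivity) hvar
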